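/- Let $\mu$ be a probability measure on $[0,1]$ with $1\in\operatorname{supp}\mu$ and $\mu(\{1\})=0$, let $d\nu(re^{i\theta})=d\mu(r)\times\frac{d\theta}{2\pi}$ on the unit disk $\mathbb D$, and let $\mathcal A^2_\nu(\mathbb D)$ be the weighted Bergman space of all analytic functions in $L^2(\mathbb D,d\nu)$, with the orthogonal projection $P_\nu:L^2(\mathbb D,d\nu)\to\mathcal A^2_\nu(\mathbb D)$ and the Toeplitz operators $T_\varphi f=P_\nu(\varphi f)$ for $\varphi\in L^\infty(\mathbb D,\nu)$. Put $\gamma_t=\int_{[0,1]}x^t\,d\mu(x)$ and $e_k=\gamma_{2k}^{-1/2}z^k$ for $k\ge 0$; then $\{e_k\}_{k\ge0}$ is an orthonormal basis of $\mathcal A^2_\nu(\mathbb D)$. Let $\mathcal L$ and $\mathcal R$ denote the left and right shift operators on $\ell^2(\mathbb N_0)$. Let $n\ge 1$, and let $q:[0,1]\to\mathbb C$ be in $L^\infty([0,1],\mu)$ and continuously differentiable in a neighborhood of $1$ in $[0,1]$. Put $T=T_{z^n}$, $D=T_{q(|z|)}$ and $\alpha=q'(1)/(2n)$. Then $T$ is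 a hyponormal weighted shift of multiplicity $n$ and $D$ is a diagonal operator, both with respect to $\{e_k\}$, and $\ker[T^*,T]=\{0\}$. The operator \[ J=[T^*,T]^{-1/2}\bigl([T^*,D]+[D^*,T]\bigr)[T^*,T]^{-1/2} \] is densely defined and bounded, and (its bounded extension to $\mathcal A^2_\nu(\mathbb D)$) is, in the basis $\{e_k\}$, a compact perturbation of $\alpha\mathcal L^n+\bar\alpha\mathcal R^n$. As a consequence, if $q(t)=t^s$ with $0<s<\infty$, then $\|J\|\ge \frac{s}{n}$. -/

import Mathlib

open MeasureTheory Set Filter Topology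
open scoped ENNReal InnerProductSpace

noncomputable section

/-! ### Hyponormal operators and the operator `J` -/

/-- The self-commutator `[T*, T] = T* T - T T*`. -/
def selfCommutator {H : Type*} [NormedAddCommGroup H] [InnerProductSpace ℂ H] [CompleteSpace H]
    (T : H →L[ℂ] H) : H →L[ℂ] H :=
  ContinuousLinearMap.adjoint T * T - T * ContinuousLinearMap.adjoint T

/-- `T` is hyponormal if `[T*, T] ≥ 0`. -/
def IsHyponormal {H : Type*} [NormedAddCommGroup H] [InnerProductSpace ℂ H] [CompleteSpace H]
    (T : H →L[ℂ] H) : Prop :=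
  (selfCommutator T).IsPositive

/-- `T` is a weighted shift of multiplicity `n` with respect to the orthonormal basis `b`. -/
def IsWeightedShift {H : Type*} [NormedAddCommGroup H] [InnerProductSpace ℂ H]
    (b : HilbertBasis ℕ ℂ H) (n : ℕ) (T : H →L[ℂ] H) : Prop :=
  ∃ a : ℕ → ℂ, ∀ k, T (b k) = a k • b (k + n)

/-- `D` is diagonal with respect to the orthonormal basis `b`. -/
def IsDiagonal {H : Type*} [NormedAddCommGroup H] [InnerProductSpace ℂ H]
    (b : HilbertBasis ℕ ℂ H) (D : H →L[ℂ] H) : Prop :=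
  ∃ a : ℕ → ℂ, ∀ k, D (b k) = a k • b k

/-- The product `g f` of two (unbounded) operators, on its maximal domain
`{x ∈ dom f | f x ∈ dom g}`. -/
def pmapMul {H : Type*} [AddCommGroup H] [Module ℂ H] (g f : H →ₗ.[ℂ] H) : H →ₗ.[ℂ] H :=
  g.comp (f.domRestrict ((g.domain.comap f.toFun).map f.domain.subtype)) (by
    rintro ⟨x, hx⟩
    obtain ⟨⟨y, hy, hyx⟩, hxf⟩ := hx
    obtain rfl : (y : H) = x := hyx
    exact hy)

/-- The (in general unbounded) operator `C^{-1/2}` of a positive injective bounded operator `C`,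
with domain the range of `C^{1/2}`. -/
def invSqrt {H : Type*} [NormedAddCommGroup H] [InnerProductSpace ℂ H] [CompleteSpace H]
    (C : H →L[ℂ] H) : H →ₗ.[ℂ] H :=
  (((CFC.sqrt C : H →L[ℂ] H) : H →ₗ[ℂ] H).toPMap ⊤).inverse

/-- `[T*, T]^{-1/2} ([T*, D] + [D*, T]) [T*, T]^{-1/2}`, on its maximal domain. -/
def operatorJ {H : Type*} [NormedAddCommGroup H] [InnerProductSpace ℂ H] [CompleteSpace H]
    (T D : H →L[ℂ] H) : H →ₗ.[ℂ] H :=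
  pmapMul (invSqrt (selfCommutator T)) (pmapMul
    ((((ContinuousLinearMap.adjoint T * D - D * ContinuousLinearMap.adjoint T)
      + (ContinuousLinearMap.adjoint D * T - T * ContinuousLinearMap.adjoint D) : H →L[ℂ] H)
        : H →ₗ[ℂ] H).toPMap ⊤)
    (invSqrt (selfCommutator T)))

/-- The densely defined operator `A` is bounded, and `B` is its unique bounded extension to the
whole space. -/
def IsBoundedExtension {H : Type*} [NormedAddCommGroup H] [InnerProductSpace ℂ H]
    (A : H →ₗ.[ℂ] H) (B : H →L[ℂ] H) : Prop :=
  Dense (A.domain : Set H) ∧ ∀ x : A.domain, B x = A x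

/-! ### The shifts on `ℓ²(ℕ₀)` -/

/-- The Hilbert space `ℓ²(ℕ₀)`. -/
abbrev EllTwo : Type := lp (fun _ : ℕ => ℂ) 2

theorem summable_sq_of_ellTwo (x : EllTwo) : Summable fun k => ‖x k‖ ^ (2 : ℝ) := by
  simpa using (memℓp_gen_iff (p := 2) (by norm_num)).1 (lp.memℓp x)

theorem norm_sq_ellTwo (x : EllTwo) : ‖x‖ ^ (2 : ℝ) = ∑' k, ‖x k‖ ^ (2 : ℝ) := by
  simpa using lp.norm_rpow_eq_tsum (p := 2) (by norm_num) x

/-- The left shift `(x₀, x₁, x₂, …) ↦ (x₁, x₂, …)`. -/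
def leftShift : EllTwo →L[ℂ] EllTwo :=
  LinearMap.mkContinuous
    { toFun := fun x => ⟨fun k => x (k + 1), (memℓp_gen_iff (p := 2) (by norm_num)).2 (by
        simpa using (summable_nat_add_iff 1).2 (summable_sq_of_ellTwo x))⟩
      map_add' := fun x y => by ext k; rfl
      map_smul' := fun c x => by ext k; rfl } 1 (by
    intro x
    rw [one_mul]
    refine (Real.rpow_le_rpow_iff (norm_nonneg _) (norm_nonneg _) (z := 2) (by norm_num)).1 ?_
    rw [norm_sq_ellTwo, norm_sq_ellTwo, (summable_sq_of_ellTwo x).tsum_eq_zero_add]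
    exact le_add_of_nonneg_left (by positivity))

/-- The right shift `(x₀, x₁, x₂, …) ↦ (0, x₀, x₁, …)`. -/
def rightShift : EllTwo →L[ℂ] EllTwo :=
  LinearMap.mkContinuous
    { toFun := fun x => ⟨fun k => if k = 0 then 0 else x (k - 1),
        (memℓp_gen_iff (p := 2) (by norm_num)).2 (by
          refine (summable_nat_add_iff 1).1 ?_
          simpa using summable_sq_of_ellTwo x)⟩
      map_add' := fun x y => by
        ext k
        change (if k = 0 then (0 : ℂ) else (x + y : EllTwo) (k - 1)) =
          (if k = 0 then (0 : ℂ) else x (k - 1)) + (if k = 0 then (0 : ℂ) else y (k - 1))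
        by_cases hk : k = 0 <;> simp [hk]
      map_smul' := fun c x => by
        ext k
        by_cases hk : k = 0 <;> simp [hk] } 1 (by
    intro x
    rw [one_mul]
    refine (Real.rpow_le_rpow_iff (norm_nonneg _) (norm_nonneg _) (z := 2) (by norm_num)).1 ?_
    rw [norm_sq_ellTwo, norm_sq_ellTwo, (summable_sq_of_ellTwo _).tsum_eq_zero_add]
    simp)

/-! ### Radially weighted Bergman spaces -/

/-- A probability measure `μ` on `[0,1]` with `1 ∈ supp μ` and `μ({1}) = 0`
(realized as a measure on `ℝ` carried by `[0,1]`). -/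
structure RadialWeight where
  μ : Measure ℝ
  isProbabilityMeasure : IsProbabilityMeasure μ
  carried : μ (Icc 0 1)ᶜ = 0
  one_mem_support : (1 : ℝ) ∈ μ.support
  measure_one : μ {1} = 0

namespace RadialWeight

instance (w : RadialWeight) : IsProbabilityMeasure w.μ := w.isProbabilityMeasure

/-- The normalized measure `dθ / 2π` on `(0, 2π]`. -/
def angleMeasure : Measure ℝ :=
  ENNReal.ofReal (1 / (2 * Real.pi)) • volume.restrict (Ioc 0 (2 * Real.pi))

instance : IsProbabilityMeasure angleMeasure := by
  constructor
  have h : 0 < 2 * Real.pi := by positivity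
  simp only [angleMeasure, Measure.smul_apply, Measure.restrict_apply MeasurableSet.univ,
    univ_inter, Real.volume_Ioc, sub_zero, smul_eq_mul]
  rw [← ENNReal.ofReal_mul (by positivity), one_div_mul_cancel h.ne', ENNReal.ofReal_one]

/-- Polar coordinates `(r, θ) ↦ r e^{iθ}`. -/
def polar (p : ℝ × ℝ) : ℂ := p.1 * Complex.exp (p.2 * Complex.I)

theorem measurable_polar : Measurable polar := by
  unfold polar
  fun_prop

theorem norm_polar (p : ℝ × ℝ) : ‖polar p‖ = |p.1| := by
  simp [polar, Complex.norm_exp_ofReal_mul_I]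

/-- The measure `dν(r e^{iθ}) = dμ(r) × dθ/2π`. -/
def diskMeasure (w : RadialWeight) : Measure ℂ := (w.μ.prod angleMeasure).map polar

instance (w : RadialWeight) : IsProbabilityMeasure w.diskMeasure :=
  Measure.isProbabilityMeasure_map measurable_polar.aemeasurable

theorem ae_mem_Ico (w : RadialWeight) : ∀ᵐ r ∂w.μ, r ∈ Ico (0 : ℝ) 1 := by
  have h1 : ∀ᵐ r ∂w.μ, r ∈ Icc (0 : ℝ) 1 := w.carried
  have h2 : ∀ᵐ r ∂w.μ, r ≠ 1 := by
    have h := measure_eq_zero_iff_ae_notMem.1 w.measure_one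
    filter_upwards [h] with r hr
    simpa using hr
  filter_upwards [h1, h2] with r h1 h2
  exact ⟨h1.1, lt_of_le_of_ne h1.2 h2⟩

/-- `|z|` is distributed according to `μ` under `ν`. -/
theorem map_norm_diskMeasure (w : RadialWeight) : w.diskMeasure.map (fun z => ‖z‖) = w.μ := by
  rw [diskMeasure, Measure.map_map measurable_norm measurable_polar]
  have h : ((fun z : ℂ => ‖z‖) ∘ polar) =ᵐ[w.μ.prod angleMeasure] Prod.fst := by
    have h1 : ∀ᵐ p ∂(w.μ.prod angleMeasure), p.1 ∈ Ico (0 : ℝ) 1 :=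
      Measure.quasiMeasurePreserving_fst.ae w.ae_mem_Ico
    filter_upwards [h1] with p hp
    simp [norm_polar, abs_of_nonneg hp.1]
  rw [Measure.map_congr h]
  simp

theorem measurePreserving_norm (w : RadialWeight) :
    MeasurePreserving (fun z : ℂ => ‖z‖) w.diskMeasure w.μ :=
  ⟨measurable_norm, w.map_norm_diskMeasure⟩

/-- `ν` is carried by the open unit disk. -/
theorem ae_mem_ball (w : RadialWeight) : ∀ᵐ z ∂w.diskMeasure, z ∈ Metric.ball (0 : ℂ) 1 := by
  filter_upwards [w.measurePreserving_norm.quasiMeasurePreserving.ae w.ae_mem_Ico] with z hz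
  simpa using hz.2

theorem measure_Ico_pos (w : RadialWeight) {r : ℝ} (hr : r < 1) : 0 < w.μ (Ico r 1) := by
  have h := (Measure.mem_support_iff_forall (1 : ℝ)).1 w.one_mem_support (Ioi r) (Ioi_mem_nhds hr)
  refine h.trans_le (measure_mono_ae ?_)
  filter_upwards [w.ae_mem_Ico] with x hx hxr
  exact ⟨le_of_lt hxr, hx.2⟩

/-- The weighted Bergman space `A²_ν(𝔻)`: the elements of `L²(𝔻, dν)` that are represented by an
analytic function on the unit disk. -/
def bergman (w : RadialWeight) : Submodule ℂ (Lp ℂ 2 w.diskMeasure) where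
  carrier := {f | ∃ g : ℂ → ℂ, AnalyticOnNhd ℂ g (Metric.ball 0 1) ∧ f =ᵐ[w.diskMeasure] g}
  add_mem' := by
    rintro f₁ f₂ ⟨g₁, h₁, e₁⟩ ⟨g₂, h₂, e₂⟩
    exact ⟨g₁ + g₂, h₁.add h₂, (Lp.coeFn_add f₁ f₂).trans (e₁.add e₂)⟩
  zero_mem' := ⟨0, analyticOnNhd_const, Lp.coeFn_zero _ _ _⟩
  smul_mem' := by
    rintro c f ⟨g, h, e⟩
    exact ⟨c • g, fun z hz => analyticAt_const.smul (h z hz), (Lp.coeFn_smul c f).trans (e.const_smul c)⟩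

/-! #### Completeness of the Bergman space -/

theorem enorm_le_lintegral_circle {g : ℂ → ℂ} (hg : AnalyticOnNhd ℂ g (Metric.ball 0 1))
    {r ρ : ℝ} (hr0 : 0 ≤ r) (hρ : ρ ∈ Ico ((1 + r) / 2) 1) {z : ℂ} (hz : ‖z‖ ≤ r) :
    ENNReal.ofReal ((1 - r) / 2) * ‖g z‖ₑ ≤ ∫⁻ θ, ‖g (polar (ρ, θ))‖ₑ ∂angleMeasure := by
  obtain ⟨hρ1, hρ2⟩ := hρ
  have hr1 : r < 1 := by linarith
  have hρ0 : 0 < ρ := by linarith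
  have hzρ : z ∈ Metric.ball (0 : ℂ) ρ := by
    simp only [Metric.mem_ball, dist_zero_right]
    linarith
  have hdiff : DiffContOnCl ℂ g (Metric.ball 0 ρ) := by
    refine (hg.differentiableOn.mono ?_).diffContOnCl
    rw [closure_ball _ hρ0.ne']
    exact Metric.closedBall_subset_ball hρ2
  have hC := hdiff.circleIntegral_sub_inv_smul hzρ
  have hpi : (0 : ℝ) < 2 * Real.pi := by positivity
  have hrhs : ∫⁻ θ, ‖g (polar (ρ, θ))‖ₑ ∂angleMeasure = ENNReal.ofReal (1 / (2 * Real.pi)) *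
      ∫⁻ θ in Ioc 0 (2 * Real.pi), ‖g (polar (ρ, θ))‖ₑ := by
    rw [angleMeasure, lintegral_smul_measure, smul_eq_mul]
  have hpt : ∀ θ : ℝ, ENNReal.ofReal ((1 - r) / 2) *
      ‖deriv (circleMap 0 ρ) θ • ((circleMap 0 ρ θ - z)⁻¹ • g (circleMap 0 ρ θ))‖ₑ ≤
        ‖g (polar (ρ, θ))‖ₑ := by
    intro θ
    have e1 : circleMap 0 ρ θ = polar (ρ, θ) := by simp [circleMap, polar]
    have e2 : (1 - r) / 2 ≤ ‖circleMap 0 ρ θ - z‖ := by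
      have h1 := norm_sub_norm_le (circleMap 0 ρ θ) z
      have h2 : ‖circleMap 0 ρ θ‖ = ρ := by simp [abs_of_pos hρ0]
      rw [h2] at h1
      linarith
    have e3 : 0 < (1 - r) / 2 := by linarith
    rw [← ofReal_norm, ← ofReal_norm, ← ENNReal.ofReal_mul e3.le]
    refine ENNReal.ofReal_le_ofReal ?_
    rw [norm_smul, norm_smul, norm_inv, e1.symm]
    have e4 : ‖deriv (circleMap 0 ρ) θ‖ = ρ := by simp [abs_of_pos hρ0]
    rw [e4]
    have e5 : (1 - r) / 2 * ‖circleMap 0 ρ θ - z‖⁻¹ ≤ 1 := by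
      rw [← div_eq_mul_inv]
      exact div_le_one_of_le₀ e2 (norm_nonneg _)
    calc (1 - r) / 2 * (ρ * (‖circleMap 0 ρ θ - z‖⁻¹ * ‖g (circleMap 0 ρ θ)‖))
        = ((1 - r) / 2 * ‖circleMap 0 ρ θ - z‖⁻¹) * ρ * ‖g (circleMap 0 ρ θ)‖ := by ring
      _ ≤ 1 * 1 * ‖g (circleMap 0 ρ θ)‖ := by gcongr
      _ = ‖g (circleMap 0 ρ θ)‖ := by ring
  have hI : ENNReal.ofReal (2 * Real.pi) * ‖g z‖ₑ ≤ ∫⁻ θ in Ioc 0 (2 * Real.pi),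
      ‖deriv (circleMap 0 ρ) θ • ((circleMap 0 ρ θ - z)⁻¹ • g (circleMap 0 ρ θ))‖ₑ := by
    have e : ENNReal.ofReal (2 * Real.pi) * ‖g z‖ₑ =
        ‖∮ ζ in C(0, ρ), (ζ - z)⁻¹ • g ζ‖ₑ := by
      rw [hC, enorm_smul]
      congr 1
      rw [← ofReal_norm]
      simp [abs_of_pos Real.pi_pos]
    rw [e, circleIntegral, intervalIntegral.integral_of_le hpi.le]
    exact enorm_integral_le_lintegral_enorm _
  have hone : ENNReal.ofReal (1 / (2 * Real.pi)) * ENNReal.ofReal (2 * Real.pi) = 1 := by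
    rw [← ENNReal.ofReal_mul (by positivity), one_div_mul_cancel hpi.ne', ENNReal.ofReal_one]
  rw [hrhs]
  calc ENNReal.ofReal ((1 - r) / 2) * ‖g z‖ₑ
      = ENNReal.ofReal (1 / (2 * Real.pi)) * (ENNReal.ofReal ((1 - r) / 2) *
          (ENNReal.ofReal (2 * Real.pi) * ‖g z‖ₑ)) := by
        rw [mul_left_comm (ENNReal.ofReal ((1 - r) / 2)), ← mul_assoc, hone, one_mul]
    _ ≤ ENNReal.ofReal (1 / (2 * Real.pi)) * (ENNReal.ofReal ((1 - r) / 2) *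
          ∫⁻ θ in Ioc 0 (2 * Real.pi),
            ‖deriv (circleMap 0 ρ) θ • ((circleMap 0 ρ θ - z)⁻¹ • g (circleMap 0 ρ θ))‖ₑ) := by
        gcongr
    _ ≤ _ := by
        rw [← lintegral_const_mul' _ _ ENNReal.ofReal_ne_top]
        gcongr with θ
        exact hpt θ

theorem enorm_le_lintegral_disk (w : RadialWeight) {g : ℂ → ℂ}
    (hg : AnalyticOnNhd ℂ g (Metric.ball 0 1)) {r : ℝ} (hr0 : 0 ≤ r) {z : ℂ}
    (hz : ‖z‖ ≤ r) :
    w.μ (Ico ((1 + r) / 2) 1) * (ENNReal.ofReal ((1 - r) / 2) * ‖g z‖ₑ) ≤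
      ∫⁻ z, ‖g z‖ₑ ∂w.diskMeasure := by
  classical
  have hmeas : Measurable ((Metric.ball (0 : ℂ) 1).indicator g) :=
    (hg.continuousOn.measurable_piecewise continuousOn_const Metric.isOpen_ball.measurableSet)
  have hcongr : ∫⁻ z, ‖g z‖ₑ ∂w.diskMeasure =
      ∫⁻ z, ‖(Metric.ball (0 : ℂ) 1).indicator g z‖ₑ ∂w.diskMeasure := by
    refine lintegral_congr_ae ?_
    filter_upwards [w.ae_mem_ball] with z hz
    rw [indicator_of_mem hz]
  rw [hcongr, diskMeasure, lintegral_map hmeas.enorm measurable_polar,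
    lintegral_prod (fun p => ‖(Metric.ball (0 : ℂ) 1).indicator g (polar p)‖ₑ)
      (hmeas.comp measurable_polar).enorm.aemeasurable, mul_comm,
    ← setLIntegral_const]
  refine (setLIntegral_mono' measurableSet_Ico fun ρ hρ => ?_).trans (setLIntegral_le_lintegral _ _)
  refine (enorm_le_lintegral_circle hg hr0 hρ hz).trans_eq ?_
  refine lintegral_congr fun θ => ?_
  rw [indicator_of_mem]
  simp only [Metric.mem_ball, dist_zero_right, norm_polar]
  rw [abs_of_nonneg (by linarith [hρ.1])]
  exact hρ.2

theorem isClosed_bergman (w : RadialWeight) : IsClosed (w.bergman : Set (Lp ℂ 2 w.diskMeasure)) := by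
  refine isSeqClosed_iff_isClosed.1 ?_
  intro f F hf hlim
  choose g hg hfg using hf
  -- the analytic representatives are uniformly Cauchy on every smaller disk
  have hcauchy : ∀ r : ℝ, 0 ≤ r → r < 1 →
      UniformCauchySeqOn g atTop (Metric.closedBall (0 : ℂ) r) := by
    intro r hr0 hr1
    set c : ℝ≥0∞ := w.μ (Ico ((1 + r) / 2) 1) * ENNReal.ofReal ((1 - r) / 2) with hc
    have hc0 : c ≠ 0 := mul_ne_zero (w.measure_Ico_pos (by linarith)).ne'
      (by simpa using hr1)
    have hct : c ≠ ∞ := ENNReal.mul_ne_top (measure_ne_top _ _) ENNReal.ofReal_ne_top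
    have hbound : ∀ i j, ∀ z ∈ Metric.closedBall (0 : ℂ) r,
        c * edist (g i z) (g j z) ≤ edist (f i) (f j) := by
      intro i j z hz
      have h1 := w.enorm_le_lintegral_disk ((hg i).sub (hg j)) hr0 (z := z) (by simpa using hz)
      rw [← mul_assoc, ← hc] at h1
      rw [edist_eq_enorm_sub]
      refine h1.trans ?_
      rw [Lp.edist_def, ← eLpNorm_one_eq_lintegral_enorm,
        eLpNorm_congr_ae ((hfg i).symm.sub (hfg j).symm)]
      exact eLpNorm_le_eLpNorm_of_exponent_le (by norm_num)
        ((Lp.aestronglyMeasurable (f i)).sub (Lp.aestronglyMeasurable (f j)))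
    intro u hu
    obtain ⟨ε, hε, hεu⟩ := mem_uniformity_edist.1 hu
    have hev : ∀ᶠ m : ℕ × ℕ in atTop ×ˢ atTop, edist (f m.1) (f m.2) < c * ε := by
      have h := cauchySeq_iff_tendsto.1 hlim.cauchySeq
        (edist_mem_uniformity (ENNReal.mul_pos hc0 hε.ne'))
      rwa [prod_atTop_atTop_eq]
    filter_upwards [hev] with m hm z hz
    exact hεu ((ENNReal.mul_lt_mul_iff_right hc0 hct).1 ((hbound m.1 m.2 z hz).trans_lt hm))
  have hpt : ∀ z ∈ Metric.ball (0 : ℂ) 1, ∃ y, Tendsto (fun i => g i z) atTop (𝓝 y) := by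
    intro z hz
    exact cauchySeq_tendsto_of_complete ((hcauchy ‖z‖ (norm_nonneg z) (by simpa using hz)).cauchySeq
      (x := z) (by simp))
  choose! G hG using hpt
  have hloc : TendstoLocallyUniformlyOn g G atTop (Metric.ball (0 : ℂ) 1) := by
    refine (tendstoLocallyUniformlyOn_iff_forall_isCompact Metric.isOpen_ball).2 ?_
    intro K hK hKc
    obtain ⟨r, hr, hKr⟩ := exists_lt_subset_ball hKc.isClosed hK
    have hr' : max r 0 < 1 := max_lt hr one_pos
    refine TendstoUniformlyOn.mono (s := Metric.closedBall (0 : ℂ) (max r 0)) ?_ (hKr.trans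
      (Metric.ball_subset_closedBall.trans (Metric.closedBall_subset_closedBall (le_max_left _ _))))
    exact (hcauchy _ (le_max_right _ _) hr').tendstoUniformlyOn_of_tendsto fun z hz =>
      hG z (Metric.closedBall_subset_ball hr' hz)
  refine ⟨G, (hloc.differentiableOn (Eventually.of_forall fun i => (hg i).differentiableOn)
    Metric.isOpen_ball).analyticOnNhd Metric.isOpen_ball, ?_⟩
  obtain ⟨ns, hns, hae⟩ := (tendstoInMeasure_of_tendsto_Lp hlim).exists_seq_tendsto_ae
  filter_upwards [hae, w.ae_mem_ball, ae_all_iff.2 hfg] with z hz hzb hzf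
  refine tendsto_nhds_unique hz ?_
  refine ((hG z hzb).comp hns.tendsto_atTop).congr fun i => ?_
  exact (hzf (ns i)).symm

instance (w : RadialWeight) : CompleteSpace w.bergman :=
  w.isClosed_bergman.completeSpace_coe

/-! #### Monomials and Toeplitz operators -/

/-- The moments `γ_t = ∫ x^t dμ(x)`. -/
def moment (w : RadialWeight) (t : ℝ) : ℝ := ∫ x, x ^ t ∂w.μ

theorem memLp_pow (w : RadialWeight) (k : ℕ) (p : ℝ≥0∞) :
    MemLp (fun z : ℂ => z ^ k) p w.diskMeasure := by
  refine MemLp.of_bound (by fun_prop) 1 ?_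
  filter_upwards [w.ae_mem_ball] with z hz
  rw [norm_pow]
  exact pow_le_one₀ (norm_nonneg _) (le_of_lt (by simpa using hz))

theorem memLp_radial (w : RadialWeight) {q : ℝ → ℂ} {p : ℝ≥0∞} (hq : MemLp q p w.μ) :
    MemLp (fun z : ℂ => q ‖z‖) p w.diskMeasure :=
  hq.comp_measurePreserving w.measurePreserving_norm

theorem memLp_rpow (w : RadialWeight) {s : ℝ} (hs : 0 ≤ s) :
    MemLp (fun t : ℝ => ((t ^ s : ℝ) : ℂ)) ∞ w.μ := by
  refine MemLp.of_bound (by fun_prop) 1 ?_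
  filter_upwards [w.ae_mem_Ico] with t ht
  rw [Complex.norm_real, Real.norm_of_nonneg (Real.rpow_nonneg ht.1 s)]
  exact Real.rpow_le_one ht.1 ht.2.le hs

/-- The monomial `z ^ k` as an element of `A²_ν(𝔻)`. -/
def monomial (w : RadialWeight) (k : ℕ) : w.bergman :=
  ⟨(w.memLp_pow k 2).toLp, fun z => z ^ k, analyticOnNhd_id.pow k, (w.memLp_pow k 2).coeFn_toLp⟩

/-- The normalized monomials `e_k = γ_{2k}^{-1/2} z^k`. -/
def normalizedMonomial (w : RadialWeight) (k : ℕ) : w.bergman :=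
  ((w.moment (2 * k) ^ (-(1 / 2) : ℝ) : ℝ) : ℂ) • w.monomial k

/-- The Toeplitz operator `T_φ f = P_ν (φ f)` on `A²_ν(𝔻)` with symbol `φ ∈ L^∞(𝔻, ν)`. -/
def toeplitz (w : RadialWeight) (φ : ℂ → ℂ) (hφ : MemLp φ ∞ w.diskMeasure) :
    w.bergman →L[ℂ] w.bergman :=
  w.bergman.orthogonalProjectionOnto ∘L
    (ContinuousLinearMap.mul ℂ ℂ).holderL w.diskMeasure ∞ 2 2 hφ.toLp ∘L w.bergman.subtypeL

/-- `T_{z^n}`. -/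
def shiftT (w : RadialWeight) (n : ℕ) : w.bergman →L[ℂ] w.bergman :=
  w.toeplitz (fun z => z ^ n) (w.memLp_pow n ∞)

/-- `T_{q(|z|)}` for `q ∈ L^∞([0,1], μ)`. -/
def radialD (w : RadialWeight) (q : ℝ → ℂ) (hq : MemLp q ∞ w.μ) : w.bergman →L[ℂ] w.bergman :=
  w.toeplitz (fun z => q ‖z‖) (w.memLp_radial hq)

/-- `α L^n + ᾱ R^n`, transported to `A²_ν(𝔻)` by means of the orthonormal basis `b`. -/
def shiftModel (w : RadialWeight) (b : HilbertBasis ℕ ℂ w.bergman) (n : ℕ) (α : ℂ) :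
    w.bergman →L[ℂ] w.bergman :=
  (b.repr.symm : EllTwo →L[ℂ] w.bergman) ∘L
    (α • leftShift ^ n + starRingEnd ℂ α • rightShift ^ n) ∘L (b.repr : w.bergman →L[ℂ] EllTwo)

end RadialWeight

end

/-! In the basis $e_k$ everything is explicit. With $a_k=\sqrt{\gamma_{2k+2n}/\gamma_{2k}}$ and
$d_k=\gamma_{2k}^{-1}\int q\,x^{2k}\,d\mu$ one has $Te_k=a_ke_{k+n}$ and $De_k=d_ke_k$, and
$[T^*,T]$ is diagonal with entries $c_k=a_k^2-a_{k-n}^2$ (no second term for $k<n$). Hence $J$ has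
to be $\tau\mathcal L^n+\mathcal R^n\bar\tau$ with $\tau_k=a_k(d_{k+n}-d_k)/\sqrt{c_kc_{k+n}}$, and
all that matters is $\tau_k\to\alpha$: convergence gives boundedness, compactness of the difference
from the model, and the norm bound.

The limit comes from symmetrizing over $\mu\times\mu$. Up to the common factor
$1/(2\gamma_{2k}\gamma_{2k+2n})$, $c_{k+n}$ is the integral of $(x^{2n}-y^{2n})^2(xy)^{2k}$
(`shiftGap_add`), and $d_{k+n}-d_k$ that of $(q(x)-q(y))(x^{2n}-y^{2n})(xy)^{2k}$
(`radialEigenvalue_sub`). The first is positive, which gives hyponormality and the trivial kernel.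
As $k\to\infty$ the weight concentrates at $(1,1)$, where $q(x)-q(y)\approx\alpha(x^{2n}-y^{2n})$,
so the quotient tends to $\alpha$ (`tendsto_covMoment_div_varMoment`). The remaining factors $a_k$
and $\sqrt{c_{k+n}/c_k}$ tend to 1, because quotients of power moments at a fixed index distance do
(`tendsto_integral_mul_pow_add_div`).

For the norm, sums of basis vectors along far-out progressions of step $n$ give
$2\operatorname{Re}\alpha\le\|J\|$ (`two_mul_re_le_norm_weightedModel`); for $q(t)=t^s$ the left
side is $s/n$. -/

noncomputable section

/-! ### Products and inverses of partially defined operators -/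

section PartialOperators

variable {H : Type*}

theorem mem_pmapMul_domain [AddCommGroup H] [Module ℂ H] {g f : H →ₗ.[ℂ] H} {x : H} :
    x ∈ (pmapMul g f).domain ↔ ∃ h : x ∈ f.domain, f ⟨x, h⟩ ∈ g.domain := by
  constructor
  · rintro ⟨⟨y, hy, rfl⟩, hx⟩
    exact ⟨y.2, hy⟩
  · rintro ⟨h, hg⟩
    exact ⟨⟨⟨x, h⟩, hg, rfl⟩, h⟩

theorem pmapMul_apply [AddCommGroup H] [Module ℂ H] {g f : H →ₗ.[ℂ] H} {x y : H}
    (hx : x ∈ (pmapMul g f).domain) (hxf : x ∈ f.domain) (hy : y ∈ g.domain)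
    (hxy : f ⟨x, hxf⟩ = y) : pmapMul g f ⟨x, hx⟩ = g ⟨y, hy⟩ := by
  subst hxy
  rfl

variable [NormedAddCommGroup H] [InnerProductSpace ℂ H] [CompleteSpace H]

theorem mem_invSqrt_domain {C : H →L[ℂ] H} {x : H} :
    x ∈ (invSqrt C).domain ↔ ∃ y, CFC.sqrt C y = x := by
  rw [invSqrt, LinearPMap.inverse_domain]
  constructor
  · rintro ⟨y, rfl⟩
    exact ⟨y, rfl⟩
  · rintro ⟨y, rfl⟩
    exact ⟨⟨y, trivial⟩, rfl⟩

theorem invSqrt_apply {C : H →L[ℂ] H} (hC : ∀ x, CFC.sqrt C x = 0 → x = 0) {x y : H}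
    (hx : x ∈ (invSqrt C).domain) (h : CFC.sqrt C y = x) : invSqrt C ⟨x, hx⟩ = y := by
  refine LinearPMap.inverse_apply_eq (f := ((CFC.sqrt C : H →L[ℂ] H) : H →ₗ[ℂ] H).toPMap ⊤)
    ?_ (x := ⟨y, trivial⟩) h
  rw [LinearMap.ker_eq_bot']
  intro m hm
  exact Subtype.ext (hC m hm)

/-- `[T*, D] + [D*, T]`. -/
def mixedCommutator (T D : H →L[ℂ] H) : H →L[ℂ] H :=
  (ContinuousLinearMap.adjoint T * D - D * ContinuousLinearMap.adjoint T)
    + (ContinuousLinearMap.adjoint D * T - T * ContinuousLinearMap.adjoint D)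

/-- Removes the unbounded operators. With $S=[T^*,T]^{1/2}$ injective, a bounded $J$ with
$SJS=[T^*,D]+[D^*,T]$ must agree with `operatorJ` wherever the latter is defined. The set in `hd`
consists of vectors of its maximal domain. -/
theorem isBoundedExtension_operatorJ {T D J : H →L[ℂ] H}
    (hS : ∀ x, CFC.sqrt (selfCommutator T) x = 0 → x = 0)
    (hJ : ∀ x, CFC.sqrt (selfCommutator T) (J (CFC.sqrt (selfCommutator T) x))
      = mixedCommutator T D x)
    (hd : Dense {x | ∃ y z, CFC.sqrt (selfCommutator T) y = x ∧
        mixedCommutator T D y = CFC.sqrt (selfCommutator T) z}) :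
    IsBoundedExtension (operatorJ T D) J := by
  have hfst : ∀ {y : H}, ∀ h : CFC.sqrt (selfCommutator T) y ∈ (pmapMul
    (((mixedCommutator T D : H →L[ℂ] H) : H →ₗ[ℂ] H).toPMap ⊤)
    (invSqrt (selfCommutator T))).domain, (pmapMul
    (((mixedCommutator T D : H →L[ℂ] H) : H →ₗ[ℂ] H).toPMap ⊤)
    (invSqrt (selfCommutator T))) ⟨_, h⟩ = mixedCommutator T D y := by
    intro y h
    exact pmapMul_apply h (mem_invSqrt_domain.2 ⟨y, rfl⟩) trivial
      (invSqrt_apply hS (mem_invSqrt_domain.2 ⟨y, rfl⟩) rfl)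
  constructor
  · refine hd.mono ?_
    rintro x ⟨y, z, rfl, hz⟩
    refine mem_pmapMul_domain.2 ⟨mem_pmapMul_domain.2 ⟨mem_invSqrt_domain.2 ⟨y, rfl⟩, trivial⟩, ?_⟩
    exact mem_invSqrt_domain.2 ⟨z, hz.symm.trans (hfst _).symm⟩
  · rintro ⟨x, hx⟩
    obtain ⟨h1, h2⟩ := mem_pmapMul_domain.1 hx
    obtain ⟨h3, -⟩ := mem_pmapMul_domain.1 h1
    obtain ⟨y, rfl⟩ := mem_invSqrt_domain.1 h3
    obtain ⟨z, hz⟩ := mem_invSqrt_domain.1 h2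
    have hz' := hz.trans (hfst h1)
    refine Eq.trans ?_ (pmapMul_apply hx h1 h2 rfl).symm
    refine Eq.trans ?_ (invSqrt_apply hS h2 hz).symm
    -- Both $J(Sy)$ and $z$ are mapped by $S$ to the mixed commutator at $y$, so injectivity of $S$
    -- identifies them.
    refine sub_eq_zero.1 (hS _ ?_)
    rw [map_sub, sub_eq_zero, hz', hJ]

end PartialOperators

/-! ### Diagonal operators on `ℓ²` -/

@[simp] theorem leftShift_apply (x : EllTwo) (k : ℕ) : leftShift x k = x (k + 1) := rfl

@[simp] theorem rightShift_apply (x : EllTwo) (k : ℕ) :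
    rightShift x k = if k = 0 then 0 else x (k - 1) := rfl

theorem leftShift_pow_apply (n : ℕ) (x : EllTwo) (k : ℕ) : (leftShift ^ n) x k = x (k + n) := by
  induction n generalizing x with
  | zero => rfl
  | succ n ih =>
    rw [pow_succ, mul_apply_eq_comp, ih, leftShift_apply, add_assoc]

theorem rightShift_pow_apply (n : ℕ) (x : EllTwo) (k : ℕ) :
    (rightShift ^ n) x k = if k < n then 0 else x (k - n) := by
  induction n generalizing x with
  | zero => rfl
  | succ n ih =>
    rw [pow_succ, mul_apply_eq_comp, ih, rightShift_apply]
    split_ifs <;> first | rfl | omega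

/-- The diagonal operator on `ℓ²` with bounded diagonal `τ`. -/
def diagonalCLM (τ : ℕ → ℂ) {C : ℝ} (hC : 0 ≤ C) (h : ∀ k, ‖τ k‖ ≤ C) : EllTwo →L[ℂ] EllTwo :=
  lp.mapCLM 2 (fun k => ContinuousLinearMap.mul ℂ ℂ (τ k)) hC (by simpa using h)

@[simp] theorem diagonalCLM_apply (τ : ℕ → ℂ) {C : ℝ} (hC : 0 ≤ C) (h : ∀ k, ‖τ k‖ ≤ C)
    (x : EllTwo) (k : ℕ) : diagonalCLM τ hC h x k = τ k * x k := rfl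

theorem norm_diagonalCLM_le (τ : ℕ → ℂ) {C : ℝ} (hC : 0 ≤ C) (h : ∀ k, ‖τ k‖ ≤ C) :
    ‖diagonalCLM τ hC h‖ ≤ C :=
  lp.norm_mapCLM_le 2 _ hC _

/-- The truncations $F_N$ to the first $N$ coordinates have finite rank. They converge in norm,
since the error is diagonal with entries from the tail of $\tau$. -/
theorem isCompactOperator_diagonalCLM {τ : ℕ → ℂ} {C : ℝ} (hC : 0 ≤ C) (h : ∀ k, ‖τ k‖ ≤ C)
    (hτ : Tendsto τ atTop (𝓝 0)) : IsCompactOperator (diagonalCLM τ hC h) := by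
  let F : ℕ → EllTwo →L[ℂ] EllTwo := fun N => ∑ i ∈ Finset.range N,
    τ i • (lp.singleContinuousLinearMap ℂ (fun _ : ℕ => ℂ) 2 i ∘L
      lp.evalCLM ℂ (fun _ : ℕ => ℂ) 2 i)
  have hF : ∀ N (x : EllTwo) k, F N x k = if k < N then τ k * x k else 0 := by
    intro N x k
    simp only [F, _root_.sum_apply, lp.coeFn_sum, Finset.sum_apply]
    simp only [_root_.smul_apply, ContinuousLinearMap.comp_apply, lp.coeFn_smul,
      Pi.smul_apply, lp.singleContinuousLinearMap_apply, lp.single_apply, smul_eq_mul]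
    simp [Pi.single_apply, lp.evalCLM]
  refine isCompactOperator_of_tendsto (F := F) (l := atTop) ?_ (Eventually.of_forall fun N => ?_)
  · rw [Metric.tendsto_atTop]
    intro ε hε
    obtain ⟨N, hN⟩ := Metric.tendsto_atTop.1 hτ (ε / 2) (by positivity)
    refine ⟨N, fun M hM => ?_⟩
    have hb : ∀ k, ‖(if k < M then 0 else -τ k : ℂ)‖ ≤ ε / 2 := by
      intro k
      split_ifs with hk
      · simp; positivity
      · simpa using (hN k (by omega)).le
    have e : F M - diagonalCLM τ hC h = diagonalCLM (fun k => if k < M then 0 else -τ k)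
        (by positivity) hb := by
      ext x k
      simp only [_root_.sub_apply, lp.coeFn_sub, Pi.sub_apply, hF, diagonalCLM_apply]
      split_ifs <;> ring
    rw [dist_eq_norm, e]
    exact (norm_diagonalCLM_le _ _ hb).trans_lt (by linarith)
  · refine Submodule.sum_mem (compactOperator (RingHom.id ℂ) EllTwo EllTwo) fun i _ => ?_
    exact ((isCompactOperator_of_locallyCompactSpace_rng
      (lp.singleContinuousLinearMap ℂ (fun _ : ℕ => ℂ) 2 i)).comp_clm _).smul (τ i)

/-! ### Weighted shifts and diagonal operators with respect to an orthonormal basis -/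

section Basis

variable {H : Type*} [NormedAddCommGroup H] [InnerProductSpace ℂ H]

theorem HilbertBasis.ext_inner (b : HilbertBasis ℕ ℂ H) {x y : H}
    (h : ∀ k, ⟪b k, x⟫_ℂ = ⟪b k, y⟫_ℂ) : x = y := by
  refine b.repr.injective ?_
  ext k
  simpa [b.repr_apply_apply] using h k

theorem HilbertBasis.clm_ext (b : HilbertBasis ℕ ℂ H) {A B : H →L[ℂ] H}
    (h : ∀ k, A (b k) = B (b k)) : A = B :=
  ContinuousLinearMap.ext_on (Submodule.dense_iff_topologicalClosure_eq_top.2 b.dense_span)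
    (by rintro _ ⟨k, rfl⟩; exact h k)

theorem HilbertBasis.inner_eq (b : HilbertBasis ℕ ℂ H) (i j : ℕ) :
    ⟪b i, b j⟫_ℂ = if i = j then 1 else 0 :=
  orthonormal_iff_ite.1 b.orthonormal i j

/-- The operator on `H` that corresponds to `τ L^n + R^n τ̄` under the orthonormal basis `b`. -/
def weightedModel (b : HilbertBasis ℕ ℂ H) (n : ℕ) (τ : ℕ → ℂ) {C : ℝ} (hC : 0 ≤ C)
    (h : ∀ k, ‖τ k‖ ≤ C) : H →L[ℂ] H :=
  (b.repr.symm : EllTwo →L[ℂ] H) ∘L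
    (diagonalCLM τ hC h ∘L (leftShift ^ n) +
      (rightShift ^ n) ∘L diagonalCLM (fun k => starRingEnd ℂ (τ k)) hC (by simpa using h)) ∘L
    (b.repr : H →L[ℂ] EllTwo)

theorem weightedModel_apply_basis (b : HilbertBasis ℕ ℂ H) (n : ℕ) (τ : ℕ → ℂ) {C : ℝ}
    (hC : 0 ≤ C) (h : ∀ k, ‖τ k‖ ≤ C) (k : ℕ) :
    weightedModel b n τ hC h (b k) =
      (if n ≤ k then τ (k - n) • b (k - n) else 0) + starRingEnd ℂ (τ k) • b (k + n) := by
  refine b.repr.injective ?_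
  ext j
  have e : ∀ i, ((if n ≤ k then b.repr (τ (k - n) • b (k - n)) else 0 : EllTwo) : ℕ → ℂ) i =
      if k = i + n then τ i else 0 := by
    intro i
    split_ifs with h1 h2 h2
    · subst h2
      simp [b.repr_self]
    · simp only [map_smul, b.repr_self, lp.coeFn_smul, Pi.smul_apply, lp.single_apply]
      rw [Pi.single_eq_of_ne (by omega), smul_zero]
    · omega
    · rfl
  have e' : ((b.repr (if n ≤ k then τ (k - n) • b (k - n) else 0) : EllTwo) : ℕ → ℂ) j =
      if k = j + n then τ j else 0 := by
    rw [← e j]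
    split_ifs <;> simp
  have hm : b.repr (weightedModel b n τ hC h (b k)) =
      diagonalCLM τ hC h ((leftShift ^ n) (b.repr (b k))) + (rightShift ^ n)
        (diagonalCLM (fun k => starRingEnd ℂ (τ k)) hC (by simpa using h) (b.repr (b k))) :=
    b.repr.apply_symm_apply _
  rw [map_add, lp.coeFn_add, Pi.add_apply, e', hm, lp.coeFn_add, Pi.add_apply, diagonalCLM_apply,
    leftShift_pow_apply, rightShift_pow_apply, diagonalCLM_apply, b.repr_self, map_smul,
    b.repr_self, lp.coeFn_smul, Pi.smul_apply]
  simp only [lp.single_apply, Pi.single_apply, smul_eq_mul, mul_ite, mul_one, mul_zero]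
  congr 1
  · exact if_congr eq_comm rfl rfl
  · by_cases hj : j = k + n
    · subst hj
      simp
    · rw [if_neg hj]
      split_ifs <;> first | rfl | omega

/-- The difference is $(\tau-\alpha)\mathcal L^n+\mathcal R^n\overline{(\tau-\alpha)}$, whose
diagonal factors tend to zero and are therefore compact. -/
theorem isCompactOperator_weightedModel_sub (b : HilbertBasis ℕ ℂ H) (n : ℕ) {τ : ℕ → ℂ} {C : ℝ}
    (hC : 0 ≤ C) (h : ∀ k, ‖τ k‖ ≤ C) {α : ℂ} (hτ : Tendsto τ atTop (𝓝 α)) :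
    IsCompactOperator (weightedModel b n τ hC h -
      (b.repr.symm : EllTwo →L[ℂ] H) ∘L
        (α • leftShift ^ n + starRingEnd ℂ α • rightShift ^ n) ∘L (b.repr : H →L[ℂ] EllTwo)) := by
  have hC' : 0 ≤ C + ‖α‖ := by positivity
  have h' : ∀ k, ‖τ k - α‖ ≤ C + ‖α‖ := fun k =>
    (norm_sub_le _ _).trans (add_le_add_left (h k) _)
  have h'' : ∀ k, ‖starRingEnd ℂ (τ k - α)‖ ≤ C + ‖α‖ := fun k => by
    rw [RCLike.norm_conj]; exact h' k
  have e : weightedModel b n τ hC h - (b.repr.symm : EllTwo →L[ℂ] H) ∘L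
        (α • leftShift ^ n + starRingEnd ℂ α • rightShift ^ n) ∘L (b.repr : H →L[ℂ] EllTwo) =
      (b.repr.symm : EllTwo →L[ℂ] H) ∘L
        (diagonalCLM (fun k => τ k - α) hC' h' ∘L (leftShift ^ n) +
          (rightShift ^ n) ∘L diagonalCLM (fun k => starRingEnd ℂ (τ k - α)) hC' h'') ∘L
        (b.repr : H →L[ℂ] EllTwo) := by
    rw [weightedModel, ← ContinuousLinearMap.comp_sub, ← ContinuousLinearMap.sub_comp]
    congr 2
    ext x k
    simp only [_root_.sub_apply, _root_.add_apply, lp.coeFn_add, Pi.add_apply, lp.coeFn_sub,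
      Pi.sub_apply, ContinuousLinearMap.comp_apply, diagonalCLM_apply, leftShift_pow_apply,
      rightShift_pow_apply, _root_.smul_apply, lp.coeFn_smul, Pi.smul_apply, smul_eq_mul, map_sub]
    split_ifs <;> ring
  have h0 : Tendsto (fun k => τ k - α) atTop (𝓝 0) := by simpa using hτ.sub_const α
  have h1 : Tendsto (fun k => starRingEnd ℂ (τ k - α)) atTop (𝓝 0) := by
    have := (Complex.continuous_conj.tendsto 0).comp h0
    rwa [map_zero] at this
  have hK : IsCompactOperator (diagonalCLM (fun k => τ k - α) hC' h' ∘L (leftShift ^ n) +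
      (rightShift ^ n) ∘L diagonalCLM (fun k => starRingEnd ℂ (τ k - α)) hC' h'') :=
    ((isCompactOperator_diagonalCLM hC' h' h0).comp_clm (leftShift ^ n)).add
      ((isCompactOperator_diagonalCLM hC' h'' h1).clm_comp (rightShift ^ n))
  rw [e]
  exact (hK.comp_clm (b.repr : H →L[ℂ] EllTwo)).clm_comp (b.repr.symm : EllTwo →L[ℂ] H)

theorem sum_sum_ite_succ (M : ℕ) (g : ℕ → ℂ) :
    ∑ i ∈ Finset.range (M + 1), ∑ j ∈ Finset.range (M + 1), (if j = i + 1 then g i else 0) =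
      ∑ i ∈ Finset.range M, g i := by
  simp only [Finset.sum_ite_eq', Finset.mem_range]
  rw [Finset.sum_range_succ, if_neg (by omega), add_zero]
  exact Finset.sum_congr rfl fun i hi => if_pos (by simpa using hi)

/-- Only the tail of $\tau$ is seen by test vectors far out, and there $J$ looks like a two-sided
Toeplitz matrix with entries $\alpha,\bar\alpha$ at distance $n$. Its quadratic form on a long
progression of step $n$ is nearly $2\operatorname{Re}\alpha$ times the squared length. -/
theorem two_mul_re_le_norm_weightedModel (b : HilbertBasis ℕ ℂ H) {n : ℕ} (hn : 1 ≤ n)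
    {τ : ℕ → ℂ} {C : ℝ} (hC : 0 ≤ C) (h : ∀ k, ‖τ k‖ ≤ C) {α : ℂ}
    (hτ : Tendsto τ atTop (𝓝 α)) : 2 * α.re ≤ ‖weightedModel b n τ hC h‖ := by
  set J := weightedModel b n τ hC h with hJ
  have hin : ∀ j k, ⟪b j, J (b k)⟫_ℂ =
      (if k = j + n then τ j else 0) + (if j = k + n then starRingEnd ℂ (τ k) else 0) := by
    intro j k
    rw [hJ, weightedModel_apply_basis, inner_add_right, inner_smul_right, b.inner_eq, mul_ite,
      mul_one, mul_zero]
    congr 1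
    split_ifs with h1 h2 h2
    · subst h2; rw [Nat.add_sub_cancel, inner_smul_right, b.inner_eq, if_pos rfl, mul_one]
    · rw [inner_smul_right, b.inner_eq, if_neg (by omega), mul_zero]
    · omega
    · simp
  -- The $M+1$ basis vectors have $M$ neighbouring pairs, hence $M$ terms on the left against
  -- $\|x\|^2=M+1$ on the right. First $N\to\infty$, then $M$ is taken large.
  have key : ∀ M N : ℕ, 2 * ∑ i ∈ Finset.range M, (τ (N + n * i)).re ≤ ‖J‖ * (M + 1) := by
    intro M N
    have hinj : ∀ i j : ℕ, N + n * i = N + n * j ↔ i = j := by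
      intro i j
      rw [add_right_inj, mul_right_inj' (by omega)]
    have hinj' : ∀ i j : ℕ, N + n * i = N + n * j + n ↔ i = j + 1 := by
      intro i j
      rw [← hinj i (j + 1)]
      ring_nf
    set x := ∑ i ∈ Finset.range (M + 1), b (N + n * i) with hx
    have hxx : ‖x‖ ^ 2 = M + 1 := by
      have : ⟪x, x⟫_ℂ = ((M + 1 : ℕ) : ℂ) := by
        simp only [hx, sum_inner, inner_sum, b.inner_eq, hinj, Finset.sum_ite_eq']
        rw [Finset.sum_congr rfl fun i hi => if_pos hi]
        simp
      have h2 := inner_self_eq_norm_sq_to_K (𝕜 := ℂ) x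
      rw [this] at h2
      exact Complex.ofReal_injective (by push_cast at h2 ⊢; exact h2.symm)
    have hxJ : (⟪x, J x⟫_ℂ).re = 2 * ∑ i ∈ Finset.range M, (τ (N + n * i)).re := by
      have e : ⟪x, J x⟫_ℂ = ∑ i ∈ Finset.range M,
          (τ (N + n * i) + starRingEnd ℂ (τ (N + n * i))) := by
        simp only [hx, map_sum, sum_inner, inner_sum, hin, hinj', Finset.sum_add_distrib]
        congr 1
        · rw [Finset.sum_comm]
          exact sum_sum_ite_succ M fun i => τ (N + n * i)
        · exact sum_sum_ite_succ M fun i => starRingEnd ℂ (τ (N + n * i))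
      rw [e, Complex.re_sum, Finset.mul_sum]
      refine Finset.sum_congr rfl fun i _ => ?_
      simp only [Complex.add_re, Complex.conj_re]
      ring
    rw [← hxJ, ← hxx]
    calc (⟪x, J x⟫_ℂ).re ≤ ‖⟪x, J x⟫_ℂ‖ := Complex.re_le_norm _
      _ ≤ ‖x‖ * ‖J x‖ := norm_inner_le_norm _ _
      _ ≤ ‖x‖ * (‖J‖ * ‖x‖) := by gcongr; exact J.le_opNorm x
      _ = ‖J‖ * ‖x‖ ^ 2 := by ring
  have key2 : ∀ M : ℕ, 2 * (M * α.re) ≤ ‖J‖ * (M + 1) := by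
    intro M
    have ht : Tendsto (fun N => 2 * ∑ i ∈ Finset.range M, (τ (N + n * i)).re) atTop
        (𝓝 (2 * ∑ i ∈ Finset.range M, α.re)) := by
      refine Tendsto.const_mul _ (tendsto_finsetSum _ fun i _ => ?_)
      exact (Complex.continuous_re.tendsto α).comp (hτ.comp (tendsto_add_atTop_nat (n * i)))
    have := le_of_tendsto' ht (key M)
    simpa using this
  by_contra! hlt
  -- `key2` reads $M(2\operatorname{Re}\alpha-\|J\|)\le\|J\|$, which fails for $M$ beyond this
  -- quotient.
  obtain ⟨M, hM⟩ := exists_nat_gt (‖J‖ / (2 * α.re - ‖J‖))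
  rw [div_lt_iff₀ (by linarith)] at hM
  have := key2 M
  linarith

end Basis

/-! ### Commutators of a weighted shift and a diagonal operator -/

section ShiftCommutators

variable {H : Type*} [NormedAddCommGroup H] [InnerProductSpace ℂ H] [CompleteSpace H]

/-- The eigenvalues of the self-commutator of a shift of multiplicity `n` with weights `a`. -/
def shiftGap (a : ℕ → ℝ) (n k : ℕ) : ℝ := a k ^ 2 - if n ≤ k then a (k - n) ^ 2 else 0

theorem adjoint_diagonal_apply (b : HilbertBasis ℕ ℂ H) {D : H →L[ℂ] H} {d : ℕ → ℂ}
    (hD : ∀ k, D (b k) = d k • b k) (k : ℕ) :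
    ContinuousLinearMap.adjoint D (b k) = starRingEnd ℂ (d k) • b k := by
  refine b.ext_inner fun j => ?_
  rw [ContinuousLinearMap.adjoint_inner_right, hD, inner_smul_left, inner_smul_right, b.inner_eq]
  split_ifs with h
  · rw [h]
  · simp

theorem adjoint_shift_apply (b : HilbertBasis ℕ ℂ H) {T : H →L[ℂ] H} {a : ℕ → ℝ} {n : ℕ}
    (hT : ∀ k, T (b k) = (a k : ℂ) • b (k + n)) (k : ℕ) :
    ContinuousLinearMap.adjoint T (b k) =
      if n ≤ k then (a (k - n) : ℂ) • b (k - n) else 0 := by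
  refine b.ext_inner fun j => ?_
  rw [ContinuousLinearMap.adjoint_inner_right, hT, inner_smul_left, b.inner_eq, Complex.conj_ofReal]
  split_ifs with h1 h2 h2
  · subst h1
    rw [Nat.add_sub_cancel, inner_smul_right, b.inner_eq, if_pos rfl]
  · omega
  · rw [inner_smul_right, b.inner_eq, if_neg (by omega), mul_zero, mul_zero]
  · simp

theorem selfCommutator_shift_apply (b : HilbertBasis ℕ ℂ H) {T : H →L[ℂ] H} {a : ℕ → ℝ} {n : ℕ}
    (hT : ∀ k, T (b k) = (a k : ℂ) • b (k + n)) (k : ℕ) :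
    selfCommutator T (b k) = (shiftGap a n k : ℂ) • b k := by
  rw [selfCommutator, _root_.sub_apply, mul_apply_eq_comp, mul_apply_eq_comp, hT, map_smul,
    adjoint_shift_apply b hT, adjoint_shift_apply b hT, if_pos (by omega), Nat.add_sub_cancel,
    shiftGap]
  split_ifs with h
  · rw [map_smul, hT, Nat.sub_add_cancel h, smul_smul, smul_smul, ← sub_smul]
    push_cast
    ring_nf
  · rw [map_zero, smul_smul, sub_zero]
    push_cast
    ring_nf

theorem isPositive_of_diagonal (b : HilbertBasis ℕ ℂ H) {C : H →L[ℂ] H} {c : ℕ → ℝ}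
    (hC : ∀ k, C (b k) = (c k : ℂ) • b k) (hc : ∀ k, 0 ≤ c k) : C.IsPositive := by
  have hself : ContinuousLinearMap.adjoint C = C := b.clm_ext fun k => by
    rw [adjoint_diagonal_apply b hC, hC, Complex.conj_ofReal]
  have hin : ∀ k x, ⟪b k, C x⟫_ℂ = c k * ⟪b k, x⟫_ℂ := by
    intro k x
    rw [← ContinuousLinearMap.adjoint_inner_left, hself, hC, inner_smul_left, Complex.conj_ofReal]
  refine ContinuousLinearMap.isPositive_def'.2 ⟨hself, fun x => ?_⟩
  refine (Complex.hasSum_re (b.hasSum_inner_mul_inner (C x) x)).nonneg fun k => ?_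
  rw [← inner_conj_symm, hin, map_mul, Complex.conj_ofReal, mul_assoc,
    ← Complex.normSq_eq_conj_mul_self, ← Complex.ofReal_mul, Complex.ofReal_re]
  exact mul_nonneg (hc k) (Complex.normSq_nonneg _)

theorem eq_zero_of_diagonal (b : HilbertBasis ℕ ℂ H) {C : H →L[ℂ] H} {c : ℕ → ℝ}
    (hC : ∀ k, C (b k) = (c k : ℂ) • b k) (hc : ∀ k, 0 < c k) (x : H) (hx : C x = 0) : x = 0 := by
  refine b.ext_inner fun k => ?_
  have h : ⟪ContinuousLinearMap.adjoint C (b k), x⟫_ℂ = 0 := by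
    rw [ContinuousLinearMap.adjoint_inner_left, hx, inner_zero_right]
  rw [adjoint_diagonal_apply b hC, inner_smul_left] at h
  rw [inner_zero_right]
  refine (mul_eq_zero.1 h).resolve_left ?_
  simpa using (hc k).ne'

/-- Positivity of $S=\sqrt C$ suffices: $v=Sb_k-\sqrt{c_k}\,b_k$ satisfies $Sv=-\sqrt{c_k}\,v$
because $S^2b_k=c_kb_k$, and a positive operator has no negative eigenvalue, so $v=0$. -/
theorem sqrt_diagonal_apply (b : HilbertBasis ℕ ℂ H) {C : H →L[ℂ] H} {c : ℕ → ℝ}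
    (hC : ∀ k, C (b k) = (c k : ℂ) • b k) (hc : ∀ k, 0 < c k) (k : ℕ) :
    CFC.sqrt C (b k) = (√(c k) : ℂ) • b k := by
  have hpos : 0 ≤ C := (ContinuousLinearMap.nonneg_iff_isPositive C).2
    (isPositive_of_diagonal b hC fun k => (hc k).le)
  have hS : (CFC.sqrt C).IsPositive :=
    (ContinuousLinearMap.nonneg_iff_isPositive _).1 (CFC.sqrt_nonneg C)
  have hSS : CFC.sqrt C (CFC.sqrt C (b k)) = (c k : ℂ) • b k := by
    rw [← hC, ← mul_apply_eq_comp, CFC.sqrt_mul_sqrt_self C hpos]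
  have hs : 0 < √(c k) := Real.sqrt_pos.2 (hc k)
  set v := CFC.sqrt C (b k) - (√(c k) : ℂ) • b k with hv
  have hz : CFC.sqrt C v = -((√(c k) : ℂ) • v) := by
    rw [hv, map_sub, hSS, map_smul, smul_sub, smul_smul, ← Complex.ofReal_mul,
      Real.mul_self_sqrt (hc k).le]
    abel
  have h := hS.re_inner_nonneg_right v
  rw [hz, inner_neg_right, inner_smul_right, inner_self_eq_norm_sq_to_K] at h
  have h' : √(c k) * ‖v‖ ^ 2 ≤ 0 := by
    have e : RCLike.re (-((√(c k) : ℂ) * ((‖v‖ : ℝ) : ℂ) ^ 2)) = -(√(c k) * ‖v‖ ^ 2) := by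
      norm_cast
    have h2 := h.trans_eq e
    linarith
  have h0 : ‖v‖ ^ 2 ≤ 0 := by
    by_contra! hlt
    exact absurd h' (not_le.2 (mul_pos hs hlt))
  have : ‖v‖ = 0 := by
    have := le_antisymm h0 (by positivity)
    simpa using this
  exact sub_eq_zero.1 (norm_eq_zero.1 this)

theorem mixedCommutator_apply (b : HilbertBasis ℕ ℂ H) {T D : H →L[ℂ] H} {a : ℕ → ℝ} {d : ℕ → ℂ}
    {n : ℕ} (hT : ∀ k, T (b k) = (a k : ℂ) • b (k + n)) (hD : ∀ k, D (b k) = d k • b k) (k : ℕ) :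
    mixedCommutator T D (b k) =
      (if n ≤ k then (a (k - n) * (d k - d (k - n))) • b (k - n) else 0) +
        (a k * starRingEnd ℂ (d (k + n) - d k)) • b (k + n) := by
  rw [mixedCommutator]
  simp only [_root_.add_apply, _root_.sub_apply, mul_apply_eq_comp, hT, hD, map_smul,
    adjoint_shift_apply b hT, adjoint_diagonal_apply b hD]
  congr 1
  · split_ifs
    · rw [map_smul, hD, smul_smul, smul_smul, ← sub_smul]
      ring_nf
    · simp
  · rw [smul_smul, smul_smul, ← sub_smul, map_sub]
    ring_nf

/-- The structure of `J` for a shift `T` of multiplicity `n` and a diagonal operator `D`. -/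
theorem isBoundedExtension_weightedModel (b : HilbertBasis ℕ ℂ H) {T D : H →L[ℂ] H} {a : ℕ → ℝ}
    {d : ℕ → ℂ} {n : ℕ} (hT : ∀ k, T (b k) = (a k : ℂ) • b (k + n))
    (hD : ∀ k, D (b k) = d k • b k) (hc : ∀ k, 0 < shiftGap a n k) {τ : ℕ → ℂ}
    (hτ : ∀ k, (√(shiftGap a n k) * √(shiftGap a n (k + n)) : ℂ) * τ k = a k * (d (k + n) - d k))
    {B : ℝ} (hB : 0 ≤ B) (h : ∀ k, ‖τ k‖ ≤ B) :
    IsBoundedExtension (operatorJ T D) (weightedModel b n τ hB h) := by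
  have hS := sqrt_diagonal_apply b (selfCommutator_shift_apply b hT) hc
  set S := CFC.sqrt (selfCommutator T)
  have hpos : ∀ k, 0 < √(shiftGap a n k) := fun k => Real.sqrt_pos.2 (hc k)
  have hne : ∀ k, (√(shiftGap a n k) : ℂ) ≠ 0 := fun k => by exact_mod_cast (hpos k).ne'
  -- Matrix coefficients are compared on the basis: the factors $\sqrt{c_k}\sqrt{c_{k+n}}$
  -- contributed by the two copies of $S$ cancel the denominator of $\tau_k$.
  have hSJS : S * weightedModel b n τ hB h * S = mixedCommutator T D := by
    refine b.clm_ext fun k => ?_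
    rw [mixedCommutator_apply b hT hD, mul_apply_eq_comp, mul_apply_eq_comp, hS, map_smul,
      weightedModel_apply_basis, map_smul, map_add, map_smul, hS, smul_add]
    congr 1
    · split_ifs with hk
      · rw [map_smul, hS, smul_smul, smul_smul]
        congr 1
        have := hτ (k - n)
        rw [Nat.sub_add_cancel hk] at this
        rw [← this]
        ring
      · simp
    · rw [smul_smul, smul_smul]
      congr 1
      have := congrArg (starRingEnd ℂ) (hτ k)
      simp only [map_mul, Complex.conj_ofReal] at this
      rw [← this]
      ring
  have hSr : ∀ k, S ((√(shiftGap a n k) : ℂ)⁻¹ • b k) = b k := by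
    intro k
    rw [map_smul, hS, smul_smul, inv_mul_cancel₀ (hne k), one_smul]
  refine isBoundedExtension_operatorJ (eq_zero_of_diagonal b hS hpos) (fun x => ?_) ?_
  · rw [← hSJS]
    rfl
  · refine (Submodule.dense_iff_topologicalClosure_eq_top.2 b.dense_span).mono ?_
    intro x hx
    induction hx using Submodule.span_induction with
    | mem x hx =>
      obtain ⟨k, rfl⟩ := hx
      refine ⟨_, (√(shiftGap a n k) : ℂ)⁻¹ •
        ((if n ≤ k then (a (k - n) * (d k - d (k - n))) •
          ((√(shiftGap a n (k - n)) : ℂ)⁻¹ • b (k - n)) else 0) +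
        (a k * starRingEnd ℂ (d (k + n) - d k)) •
          ((√(shiftGap a n (k + n)) : ℂ)⁻¹ • b (k + n))), hSr k, ?_⟩
      change mixedCommutator T D _ = S _
      rw [map_smul, map_smul, mixedCommutator_apply b hT hD, map_add S, map_smul S (_ * _), hSr]
      split_ifs
      · rw [map_smul, hSr]
      · rw [map_zero]
    | zero => exact ⟨0, 0, by simp, by simp⟩
    | add x y _ _ hx hy =>
      obtain ⟨u, v, rfl, h1⟩ := hx
      obtain ⟨u', v', rfl, h2⟩ := hy
      exact ⟨u + u', v + v', by simp, by rw [map_add, map_add, h1, h2]⟩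
    | smul r x _ hx =>
      obtain ⟨u, v, rfl, h1⟩ := hx
      exact ⟨r • u, r • v, by simp, by rw [map_smul, map_smul, h1]⟩

end ShiftCommutators

/-! ### Asymptotics of power moments -/

section PowerMoments

variable {X : Type*} [MeasurableSpace X] {m : Measure X} {f g : X → ℝ}

theorem integrable_mul_pow_of_mem_Icc (hf : Measurable f) (hf01 : ∀ᵐ x ∂m, f x ∈ Icc (0 : ℝ) 1)
    (hg : Integrable g m) (k : ℕ) : Integrable (fun x => g x * f x ^ k) m := by
  refine hg.mul_bdd (c := 1) (hf.pow_const k).aestronglyMeasurable ?_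
  filter_upwards [hf01] with x hx
  rw [norm_pow, Real.norm_of_nonneg hx.1]
  exact pow_le_one₀ hx.1 hx.2

/-- Markov's inequality for $f^k$ with respect to the density $g$; it bounds the moments below by
any geometric sequence of ratio $r<1$, up to a constant. -/
theorem pow_mul_setIntegral_le (hf : Measurable f) (hf01 : ∀ᵐ x ∂m, f x ∈ Icc (0 : ℝ) 1)
    (hg : Integrable g m) (hg0 : ∀ x, 0 ≤ g x) {r : ℝ} (hr : 0 ≤ r) (k : ℕ) :
    r ^ k * ∫ x in {x | r < f x}, g x ∂m ≤ ∫ x, g x * f x ^ k ∂m := by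
  have hs : MeasurableSet {x | r < f x} := measurableSet_lt measurable_const hf
  have hi := integrable_mul_pow_of_mem_Icc hf hf01 hg k
  rw [← integral_const_mul]
  refine (setIntegral_mono_on (hg.integrableOn.const_mul _) hi.integrableOn hs
    fun x hx => ?_).trans (setIntegral_le_integral hi ?_)
  · rw [mul_comm]
    exact mul_le_mul_of_nonneg_left (pow_le_pow_left₀ hr (le_of_lt hx) k) (hg0 x)
  · filter_upwards [hf01] with x hx
    exact mul_nonneg (hg0 x) (pow_nonneg hx.1 k)

theorem integral_mul_pow_pos (hf : Measurable f) (hf01 : ∀ᵐ x ∂m, f x ∈ Icc (0 : ℝ) 1)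
    (hg : Integrable g m) (hg0 : ∀ x, 0 ≤ g x)
    (hpos : ∀ r < 1, 0 < ∫ x in {x | r < f x}, g x ∂m) (k : ℕ) :
    0 < ∫ x, g x * f x ^ k ∂m :=
  (mul_pos (by positivity) (hpos (1 / 2) (by norm_num))).trans_le
    (pow_mul_setIntegral_le hf hf01 hg hg0 (by norm_num : (0 : ℝ) ≤ 1 / 2) k)

/-- For $r<s<1$ the moments are at least a positive constant times $s^k$, and $(r/s)^k\to0$. This
makes every contribution away from $f=1$ negligible. -/
theorem tendsto_pow_div_integral_mul_pow (hf : Measurable f)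
    (hf01 : ∀ᵐ x ∂m, f x ∈ Icc (0 : ℝ) 1) (hg : Integrable g m) (hg0 : ∀ x, 0 ≤ g x)
    (hpos : ∀ r < 1, 0 < ∫ x in {x | r < f x}, g x ∂m) {r : ℝ} (hr0 : 0 ≤ r) (hr1 : r < 1) :
    Tendsto (fun k : ℕ => r ^ k / ∫ x, g x * f x ^ k ∂m) atTop (𝓝 0) := by
  obtain ⟨s, hrs, hs1⟩ := exists_between hr1
  have hs0 : 0 < s := hr0.trans_lt hrs
  have h0 : Tendsto (fun k : ℕ => (r / s) ^ k * (∫ x in {x | s < f x}, g x ∂m)⁻¹) atTop (𝓝 0) := by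
    simpa using (tendsto_pow_atTop_nhds_zero_of_lt_one (by positivity)
      ((div_lt_one hs0).2 hrs)).mul_const (∫ x in {x | s < f x}, g x ∂m)⁻¹
  refine squeeze_zero (fun k => ?_) (fun k => ?_) h0
  · have := integral_mul_pow_pos hf hf01 hg hg0 hpos k
    positivity
  · have h1 := pow_mul_setIntegral_le hf hf01 hg hg0 hs0.le k
    have h2 := hpos s hs1
    calc r ^ k / ∫ x, g x * f x ^ k ∂m ≤ r ^ k / (s ^ k * ∫ x in {x | s < f x}, g x ∂m) := by
          gcongr
      _ = _ := by rw [div_pow, div_mul_eq_div_div, div_eq_mul_inv (r ^ k / s ^ k)]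

/-- The quotients are at most 1 since $f\le1$. From below, integrating $f^{k+1}\ge rf^k-r^{k+1}$
gives a bound tending to $r$, for each $r<1$. -/
theorem tendsto_integral_mul_pow_succ_div (hf : Measurable f)
    (hf01 : ∀ᵐ x ∂m, f x ∈ Icc (0 : ℝ) 1) (hg : Integrable g m) (hg0 : ∀ x, 0 ≤ g x)
    (hpos : ∀ r < 1, 0 < ∫ x in {x | r < f x}, g x ∂m) :
    Tendsto (fun k : ℕ => (∫ x, g x * f x ^ (k + 1) ∂m) / ∫ x, g x * f x ^ k ∂m) atTop (𝓝 1) := by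
  have hi := integrable_mul_pow_of_mem_Icc hf hf01 hg
  have hF := integral_mul_pow_pos hf hf01 hg hg0 hpos
  refine tendsto_order.2 ⟨fun c hc => ?_, fun c hc => Eventually.of_forall fun k => ?_⟩
  · obtain ⟨r, hcr, hr1⟩ := exists_between (max_lt hc one_pos)
    have hr0 : 0 ≤ r := (le_max_right c 0).trans hcr.le
    have hlim : Tendsto (fun k : ℕ => r - r * (∫ x, g x ∂m) *
        (r ^ k / ∫ x, g x * f x ^ k ∂m)) atTop (𝓝 r) := by
      simpa using ((tendsto_pow_div_integral_mul_pow hf hf01 hg hg0 hpos hr0 hr1).const_mul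
        (r * ∫ x, g x ∂m)).const_sub r
    filter_upwards [hlim.eventually (lt_mem_nhds ((le_max_left c 0).trans_lt hcr))] with k hk
    refine hk.trans_le ?_
    have h1 : r * (∫ x, g x * f x ^ k ∂m) - r ^ (k + 1) * ∫ x, g x ∂m ≤
        ∫ x, g x * f x ^ (k + 1) ∂m := by
      rw [← integral_const_mul, ← integral_const_mul, ← integral_sub ((hi k).const_mul _)
        (hg.const_mul _)]
      refine integral_mono_ae (((hi k).const_mul _).sub (hg.const_mul _)) (hi _) ?_
      filter_upwards [hf01] with x hx
      -- If $f\ge r$ then already $rf^k\le f^{k+1}$; otherwise the left side is not positive.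
      have h2 : r * f x ^ k - r ^ (k + 1) ≤ f x ^ (k + 1) := by
        rcases le_total r (f x) with h | h
        · have : r * f x ^ k ≤ f x ^ (k + 1) := by
            rw [pow_succ']
            exact mul_le_mul_of_nonneg_right h (pow_nonneg hx.1 k)
          linarith [pow_nonneg hr0 (k + 1)]
        · have : r * f x ^ k ≤ r ^ (k + 1) := by
            rw [pow_succ' r]
            exact mul_le_mul_of_nonneg_left (pow_le_pow_left₀ hx.1 h k) hr0
          linarith [pow_nonneg hx.1 (k + 1)]
      have h3 := mul_le_mul_of_nonneg_left h2 (hg0 x)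
      change r * (g x * f x ^ k) - r ^ (k + 1) * g x ≤ _
      linarith
    rw [le_div_iff₀ (hF k)]
    refine le_trans (le_of_eq ?_) h1
    have := (hF k).ne'
    field_simp
    ring
  · refine lt_of_le_of_lt ?_ hc
    rw [div_le_one (hF k)]
    refine integral_mono_ae (hi _) (hi _) ?_
    filter_upwards [hf01] with x hx
    exact mul_le_mul_of_nonneg_left (pow_le_pow_of_le_one hx.1 hx.2 (Nat.le_succ k)) (hg0 x)

theorem tendsto_integral_mul_pow_add_div (hf : Measurable f)
    (hf01 : ∀ᵐ x ∂m, f x ∈ Icc (0 : ℝ) 1) (hg : Integrable g m) (hg0 : ∀ x, 0 ≤ g x)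
    (hpos : ∀ r < 1, 0 < ∫ x in {x | r < f x}, g x ∂m) (j : ℕ) :
    Tendsto (fun k : ℕ => (∫ x, g x * f x ^ (k + j) ∂m) / ∫ x, g x * f x ^ k ∂m) atTop (𝓝 1) := by
  have hF := integral_mul_pow_pos hf hf01 hg hg0 hpos
  induction j with
  | zero => exact tendsto_const_nhds.congr fun k => (div_self (hF k).ne').symm
  | succ j ih =>
    have h := ((tendsto_integral_mul_pow_succ_div hf hf01 hg hg0 hpos).comp
      (tendsto_add_atTop_nat j)).mul ih
    rw [one_mul] at h
    refine h.congr fun k => ?_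
    exact div_mul_div_cancel₀ (hF (k + j)).ne'

end PowerMoments

/-! ### Moments of $\mu$ and symmetrized integrals over $\mu\times\mu$ -/

namespace RadialWeight

variable (w : RadialWeight)

/-- The moments of integer order. -/
def natMoment (j : ℕ) : ℝ := ∫ x, x ^ j ∂w.μ

/-- The moments of the product measure with density `(x^{2n} - y^{2n})²` in the variable `x y`. -/
def varMoment (n j : ℕ) : ℝ :=
  ∫ p : ℝ × ℝ, (p.1 ^ (2 * n) - p.2 ^ (2 * n)) ^ 2 * (p.1 * p.2) ^ j ∂(w.μ.prod w.μ)

theorem ae_prod_mem_Ico :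
    ∀ᵐ p : ℝ × ℝ ∂(w.μ.prod w.μ), p.1 ∈ Ico (0 : ℝ) 1 ∧ p.2 ∈ Ico (0 : ℝ) 1 :=
  (Measure.quasiMeasurePreserving_fst.ae w.ae_mem_Ico).and
    (Measure.quasiMeasurePreserving_snd.ae w.ae_mem_Ico)

theorem ae_mul_mem_Icc : ∀ᵐ p : ℝ × ℝ ∂(w.μ.prod w.μ), p.1 * p.2 ∈ Icc (0 : ℝ) 1 := by
  filter_upwards [w.ae_prod_mem_Ico] with p hp
  exact ⟨mul_nonneg hp.1.1 hp.2.1, mul_le_one₀ hp.1.2.le hp.2.1 hp.2.2.le⟩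

theorem ae_abs_pow_sub_pow_le (n : ℕ) :
    ∀ᵐ p : ℝ × ℝ ∂(w.μ.prod w.μ), |p.1 ^ n - p.2 ^ n| ≤ 1 := by
  filter_upwards [w.ae_prod_mem_Ico] with p hp
  have h1 := pow_nonneg hp.1.1 n
  have h2 := pow_nonneg hp.2.1 n
  have h3 := pow_le_one₀ hp.1.1 hp.1.2.le (n := n)
  have h4 := pow_le_one₀ hp.2.1 hp.2.2.le (n := n)
  exact abs_le.2 ⟨by linarith, by linarith⟩

theorem integrable_sq_pow_sub_pow (n : ℕ) :
    Integrable (fun p : ℝ × ℝ => (p.1 ^ n - p.2 ^ n) ^ 2) (w.μ.prod w.μ) := by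
  refine Integrable.of_bound (by fun_prop) 1 ?_
  filter_upwards [w.ae_abs_pow_sub_pow_le n] with p hp
  rw [norm_pow, Real.norm_eq_abs]
  exact pow_le_one₀ (abs_nonneg _) hp

theorem setIntegral_one_pos {r : ℝ} (hr : r < 1) : 0 < ∫ _ in {x : ℝ | r < x}, (1 : ℝ) ∂w.μ := by
  have h : 0 < w.μ {x : ℝ | r < x} := by
    obtain ⟨s, hrs, hs⟩ := exists_between hr
    exact (w.measure_Ico_pos hs).trans_le (measure_mono fun x hx => hrs.trans_le hx.1)
  simpa [Measure.real] using ENNReal.toReal_pos h.ne' (measure_ne_top _ _)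

/-- Continuity from below along $b\uparrow1$. Together with the mass of $[b,1)$ it yields two
disjoint intervals near 1 that both carry mass, so that $x\ne y$ on a set of positive product
measure. -/
theorem exists_measure_Ico_pos {a : ℝ} (ha : a < 1) : ∃ b, a < b ∧ b < 1 ∧ 0 < w.μ (Ico a b) := by
  obtain ⟨u, -, hu, hut⟩ := exists_seq_strictMono_tendsto' ha
  by_contra! h
  have h0 : w.μ (⋃ i, Ico a (u i)) = 0 :=
    measure_iUnion_null fun i => le_antisymm (h (u i) (hu i).1 (hu i).2) zero_le
  refine (w.measure_Ico_pos ha).ne' (measure_mono_null (fun x hx => ?_) h0)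
  obtain ⟨i, hi⟩ := (hut.eventually (lt_mem_nhds hx.2)).exists
  exact mem_iUnion.2 ⟨i, hx.1, hi⟩

theorem setIntegral_sq_pow_sub_pow_pos {n : ℕ} (hn : n ≠ 0) {r : ℝ} (hr : r < 1) :
    0 < ∫ p in {p : ℝ × ℝ | r < p.1 * p.2}, (p.1 ^ n - p.2 ^ n) ^ 2 ∂(w.μ.prod w.μ) := by
  rw [setIntegral_pos_iff_support_of_nonneg_ae (Eventually.of_forall fun p => sq_nonneg _)
    (w.integrable_sq_pow_sub_pow n).integrableOn]
  set s := max r 0 with hs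
  have hs1 : s < 1 := max_lt hr one_pos
  have hs0 : 0 ≤ s := le_max_right _ _
  have hrs : r ≤ s := le_max_left _ _
  -- For $x,y\ge(1+s)/2$ one has $xy\ge((1+s)/2)^2=s+((1-s)/2)^2>s\ge r$, so the box below lies in
  -- the domain of integration.
  obtain ⟨b, hab, hb1, hA⟩ := w.exists_measure_Ico_pos (a := (1 + s) / 2) (by linarith)
  have hB := w.measure_Ico_pos hb1
  have hAB : 0 < (w.μ.prod w.μ) (Ico ((1 + s) / 2) b ×ˢ Ico b 1) := by
    rw [Measure.prod_prod]
    exact ENNReal.mul_pos hA.ne' hB.ne'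
  refine hAB.trans_le (measure_mono ?_)
  rintro ⟨x, y⟩ ⟨⟨hx1, hx2⟩, hy1, hy2⟩
  simp only at hx1 hx2 hy1 hy2
  have hxy : x < y := hx2.trans_le hy1
  constructor
  · rw [Function.mem_support]
    exact pow_ne_zero _ (sub_ne_zero.2 (pow_lt_pow_left₀ hxy (by linarith) hn).ne)
  · change r < x * y
    nlinarith [sq_pos_of_pos (sub_pos.2 hs1)]

theorem ae_mem_Icc : ∀ᵐ x ∂w.μ, x ∈ Icc (0 : ℝ) 1 :=
  w.ae_mem_Ico.mono fun _ hx => Ico_subset_Icc_self hx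

theorem natMoment_eq (j : ℕ) : w.natMoment j = ∫ x, 1 * x ^ j ∂w.μ := by
  simp only [natMoment, one_mul]

theorem natMoment_pos (j : ℕ) : 0 < w.natMoment j := by
  rw [natMoment_eq]
  exact integral_mul_pow_pos measurable_id w.ae_mem_Icc (integrable_const _)
    (fun _ => zero_le_one) (fun r hr => w.setIntegral_one_pos hr) j

theorem tendsto_natMoment_add_div (i : ℕ) :
    Tendsto (fun j => w.natMoment (j + i) / w.natMoment j) atTop (𝓝 1) := by
  simp only [natMoment_eq]
  exact tendsto_integral_mul_pow_add_div measurable_id w.ae_mem_Icc (integrable_const _)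
    (fun _ => zero_le_one) (fun r hr => w.setIntegral_one_pos hr) i

theorem varMoment_pos {n : ℕ} (hn : 1 ≤ n) (j : ℕ) : 0 < w.varMoment n j :=
  integral_mul_pow_pos (measurable_fst.mul measurable_snd) w.ae_mul_mem_Icc
    (w.integrable_sq_pow_sub_pow (2 * n)) (fun _ => sq_nonneg _)
    (fun r hr => w.setIntegral_sq_pow_sub_pow_pos (by omega) hr) j

theorem tendsto_varMoment_add_div {n : ℕ} (hn : 1 ≤ n) (i : ℕ) :
    Tendsto (fun j => w.varMoment n (j + i) / w.varMoment n j) atTop (𝓝 1) :=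
  tendsto_integral_mul_pow_add_div (measurable_fst.mul measurable_snd) w.ae_mul_mem_Icc
    (w.integrable_sq_pow_sub_pow (2 * n)) (fun _ => sq_nonneg _)
    (fun r hr => w.setIntegral_sq_pow_sub_pow_pos (by omega) hr) i

theorem tendsto_pow_div_varMoment {n : ℕ} (hn : 1 ≤ n) {r : ℝ} (hr0 : 0 ≤ r) (hr1 : r < 1) :
    Tendsto (fun j => r ^ j / w.varMoment n j) atTop (𝓝 0) :=
  tendsto_pow_div_integral_mul_pow (measurable_fst.mul measurable_snd) w.ae_mul_mem_Icc
    (w.integrable_sq_pow_sub_pow (2 * n)) (fun _ => sq_nonneg _)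
    (fun r hr => w.setIntegral_sq_pow_sub_pow_pos (by omega) hr) hr0 hr1

theorem integrable_pow (j : ℕ) : Integrable (fun x : ℝ => x ^ j) w.μ := by
  simpa using integrable_mul_pow_of_mem_Icc measurable_id w.ae_mem_Icc
    (integrable_const (1 : ℝ)) j

/-- Expanding the square and applying Fubini turns the double integral into the log-convexity defect
of the moments. -/
theorem varMoment_eq (n j : ℕ) : w.varMoment n j =
    2 * (w.natMoment (j + 4 * n) * w.natMoment j - w.natMoment (j + 2 * n) ^ 2) := by
  have hi : ∀ a b : ℕ, Integrable (fun p : ℝ × ℝ => p.1 ^ a * p.2 ^ b) (w.μ.prod w.μ) :=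
    fun a b => (w.integrable_pow a).mul_prod (w.integrable_pow b)
  have hI : ∀ a b : ℕ, ∫ p : ℝ × ℝ, p.1 ^ a * p.2 ^ b ∂(w.μ.prod w.μ) =
      w.natMoment a * w.natMoment b := fun a b => integral_prod_mul (fun x => x ^ a) (fun x => x ^ b)
  have e : ∀ p : ℝ × ℝ, (p.1 ^ (2 * n) - p.2 ^ (2 * n)) ^ 2 * (p.1 * p.2) ^ j =
      p.1 ^ (j + 4 * n) * p.2 ^ j + p.1 ^ j * p.2 ^ (j + 4 * n) -
        2 * (p.1 ^ (j + 2 * n) * p.2 ^ (j + 2 * n)) := by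
    intro p
    ring
  rw [varMoment]
  simp only [e]
  refine (integral_sub ((hi _ _).add (hi _ _)) ((hi _ _).const_mul _)).trans ?_
  rw [integral_add' (hi _ _) (hi _ _), integral_const_mul, hI, hI, hI]
  ring

/-- The moments of integer order of `q dμ`. -/
def symbolMoment (q : ℝ → ℂ) (j : ℕ) : ℂ := ∫ x, q x * (x : ℂ) ^ j ∂w.μ

/-- The mixed second moments of `q` and `x^{2n}`. -/
def covMoment (q : ℝ → ℂ) (n j : ℕ) : ℂ :=
  ∫ p : ℝ × ℝ, (q p.1 - q p.2) * ((p.1 ^ (2 * n) - p.2 ^ (2 * n) : ℝ) : ℂ) *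
    (((p.1 * p.2) ^ j : ℝ) : ℂ) ∂(w.μ.prod w.μ)

theorem integrable_symbol_mul_pow {q : ℝ → ℂ} (hq : MemLp q ∞ w.μ) (j : ℕ) :
    Integrable (fun x : ℝ => q x * (x : ℂ) ^ j) w.μ := by
  have h : Integrable q w.μ := hq.integrable le_top
  refine h.mul_bdd (c := 1) (by fun_prop) ?_
  filter_upwards [w.ae_mem_Icc] with x hx
  rw [norm_pow, Complex.norm_real, Real.norm_of_nonneg hx.1]
  exact pow_le_one₀ hx.1 hx.2

/-- The polarized form of `varMoment_eq`, with one factor $x^{2n}-y^{2n}$ replaced by $q(x)-q(y)$;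
integrability comes from the same expansion. -/
theorem integrable_covMoment {q : ℝ → ℂ} (hq : MemLp q ∞ w.μ) (n j : ℕ) :
    Integrable (fun p : ℝ × ℝ => (q p.1 - q p.2) * ((p.1 ^ (2 * n) - p.2 ^ (2 * n) : ℝ) : ℂ) *
      (((p.1 * p.2) ^ j : ℝ) : ℂ)) (w.μ.prod w.μ) ∧
    w.covMoment q n j = 2 * (w.symbolMoment q (j + 2 * n) * w.natMoment j -
      w.symbolMoment q j * w.natMoment (j + 2 * n)) := by
  have hp : ∀ b : ℕ, Integrable (fun x : ℝ => (x : ℂ) ^ b) w.μ := fun b => by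
    simpa using (w.integrable_pow b).ofReal (𝕜 := ℂ)
  have hpI : ∀ b : ℕ, ∫ x : ℝ, (x : ℂ) ^ b ∂w.μ = w.natMoment b := fun b => by
    rw [natMoment, ← integral_complex_ofReal]
    simp
  have hi : ∀ a b : ℕ, Integrable (fun p : ℝ × ℝ => q p.1 * (p.1 : ℂ) ^ a * (p.2 : ℂ) ^ b)
      (w.μ.prod w.μ) := fun a b => (w.integrable_symbol_mul_pow hq a).mul_prod (hp b)
  have hi' : ∀ a b : ℕ, Integrable (fun p : ℝ × ℝ => (p.1 : ℂ) ^ b * (q p.2 * (p.2 : ℂ) ^ a))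
      (w.μ.prod w.μ) := fun a b => (hp b).mul_prod (w.integrable_symbol_mul_pow hq a)
  have hI : ∀ a b : ℕ, ∫ p : ℝ × ℝ, q p.1 * (p.1 : ℂ) ^ a * (p.2 : ℂ) ^ b ∂(w.μ.prod w.μ) =
      w.symbolMoment q a * w.natMoment b := fun a b => by
    rw [← hpI]
    exact integral_prod_mul (fun x : ℝ => q x * (x : ℂ) ^ a) (fun x : ℝ => (x : ℂ) ^ b)
  have hI' : ∀ a b : ℕ, ∫ p : ℝ × ℝ, (p.1 : ℂ) ^ b * (q p.2 * (p.2 : ℂ) ^ a) ∂(w.μ.prod w.μ) =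
      w.symbolMoment q a * w.natMoment b := fun a b => by
    rw [← hpI, mul_comm]
    exact integral_prod_mul (fun x : ℝ => (x : ℂ) ^ b) (fun x : ℝ => q x * (x : ℂ) ^ a)
  have e : ∀ p : ℝ × ℝ, (q p.1 - q p.2) * ((p.1 ^ (2 * n) - p.2 ^ (2 * n) : ℝ) : ℂ) *
      (((p.1 * p.2) ^ j : ℝ) : ℂ) =
      (q p.1 * (p.1 : ℂ) ^ (j + 2 * n) * (p.2 : ℂ) ^ j +
        (p.1 : ℂ) ^ j * (q p.2 * (p.2 : ℂ) ^ (j + 2 * n))) -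
      (q p.1 * (p.1 : ℂ) ^ j * (p.2 : ℂ) ^ (j + 2 * n) +
        (p.1 : ℂ) ^ (j + 2 * n) * (q p.2 * (p.2 : ℂ) ^ j)) := by
    intro p
    push_cast
    ring
  rw [covMoment]
  simp only [e]
  refine ⟨((hi _ _).add (hi' _ _)).sub ((hi _ _).add (hi' _ _)), ?_⟩
  refine (integral_sub ((hi _ _).add (hi' _ _)) ((hi _ _).add (hi' _ _))).trans ?_
  rw [integral_add' (hi _ _) (hi' _ _), integral_add' (hi _ _) (hi' _ _), hI, hI, hI', hI']
  ring

end RadialWeight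

/-! ### First-order comparison of $q$ with $x^{2n}$ near 1 -/

theorem half_pow_mul_abs_sub_le {x y : ℝ} (hx : 1 / 2 ≤ x) (hy : 1 / 2 ≤ y) (m : ℕ) :
    (1 / 2) ^ m * |x - y| ≤ |x ^ (m + 1) - y ^ (m + 1)| := by
  wlog h : y ≤ x generalizing x y
  · rw [abs_sub_comm, abs_sub_comm (x ^ _)]
    exact this hy hx (le_of_not_ge h)
  have h0 : 0 ≤ y := by linarith
  have h1 : y ^ m ≤ x ^ m := pow_le_pow_left₀ h0 h m
  have h2 : (1 / 2 : ℝ) ^ m ≤ y ^ m := pow_le_pow_left₀ (by norm_num) hy m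
  rw [abs_of_nonneg (sub_nonneg.2 h), abs_of_nonneg (sub_nonneg.2 (pow_le_pow_left₀ h0 h _))]
  calc (1 / 2) ^ m * (x - y) ≤ y ^ m * (x - y) :=
        mul_le_mul_of_nonneg_right h2 (sub_nonneg.2 h)
    _ = x * y ^ m - y ^ (m + 1) := by ring
    _ ≤ x * x ^ m - y ^ (m + 1) :=
        sub_le_sub_right (mul_le_mul_of_nonneg_left h1 (h0.trans h)) _
    _ = _ := by ring

/-- With $\alpha=q'(1)/(2n)$ the function $h=q-\alpha x^{2n}$ has $h'(1)=0$. Since $h'$ is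
continuous it is small near 1, and the mean value inequality bounds $h(x)-h(y)$ by a small multiple
of $|x-y|$, hence of $|x^{2n}-y^{2n}|$. -/
theorem exists_norm_sub_sub_le_near_one {q : ℝ → ℂ} {ε : ℝ} (hε : 0 < ε)
    (hq : ContDiffOn ℝ 1 q (Icc (1 - ε) 1)) {n : ℕ} (hn : 1 ≤ n) {η : ℝ} (hη : 0 < η) :
    ∃ r : ℝ, 0 ≤ r ∧ r < 1 ∧ ∀ x ∈ Icc r 1, ∀ y ∈ Icc r 1,
      ‖q x - q y - derivWithin q (Icc 0 1) 1 / (2 * n) * ((x ^ (2 * n) - y ^ (2 * n) : ℝ) : ℂ)‖ ≤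
        η * |x ^ (2 * n) - y ^ (2 * n)| := by
  set α : ℂ := derivWithin q (Icc 0 1) 1 / (2 * n) with hα
  set l : ℝ := max (1 - ε) (1 / 2) with hl
  have hl1 : l < 1 := max_lt (by linarith) (by norm_num)
  have hl2 : 1 / 2 ≤ l := le_max_right _ _
  have hls : Icc l 1 ⊆ Icc (1 - ε) 1 := Icc_subset_Icc_left (le_max_left _ _)
  have hqs := hq.mono hls
  have hu : UniqueDiffOn ℝ (Icc l 1) := uniqueDiffOn_Icc hl1
  have h1 : (1 : ℝ) ∈ Icc l 1 := ⟨hl1.le, le_rfl⟩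
  have hqd : ∀ x ∈ Icc l 1, HasDerivWithinAt q (derivWithin q (Icc l 1) x) (Icc l 1) x :=
    fun x hx => (hqs.differentiableOn (by norm_num) x hx).hasDerivWithinAt
  -- $[l,1]$ is a neighbourhood of 1 within $[0,1]$, so both one-sided derivatives agree.
  have hq1 : derivWithin q (Icc l 1) 1 = derivWithin q (Icc 0 1) 1 := by
    have hm : Icc l 1 ∈ 𝓝[Icc 0 1] (1 : ℝ) :=
      mem_nhdsWithin.2 ⟨Ioi l, isOpen_Ioi, hl1, fun x hx => ⟨le_of_lt hx.1, hx.2.2⟩⟩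
    exact (((hqd 1 h1).mono_of_mem_nhdsWithin hm).derivWithin
      (uniqueDiffOn_Icc zero_lt_one 1 ⟨zero_le_one, le_rfl⟩)).symm
  have hpow : ∀ x : ℝ, HasDerivAt (fun x : ℝ => α * ((x ^ (2 * n) : ℝ) : ℂ))
      (α * ((2 * n * x ^ (2 * n - 1) : ℝ) : ℂ)) x := by
    intro x
    have := ((hasDerivAt_pow (2 * n) x).ofReal_comp).const_mul α
    simpa using this
  set h : ℝ → ℂ := fun x => q x - α * ((x ^ (2 * n) : ℝ) : ℂ) with hh
  set h' : ℝ → ℂ := fun x => derivWithin q (Icc l 1) x - α * ((2 * n * x ^ (2 * n - 1) : ℝ) : ℂ)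
    with hh'
  have hd : ∀ x ∈ Icc l 1, HasDerivWithinAt h (h' x) (Icc l 1) x :=
    fun x hx => (hqd x hx).sub (hpow x).hasDerivWithinAt
  have hc : ContinuousOn h' (Icc l 1) :=
    (hqs.continuousOn_derivWithin hu le_rfl).sub (by fun_prop)
  have hn0 : (n : ℂ) ≠ 0 := by exact_mod_cast (by omega : n ≠ 0)
  have h0 : h' 1 = 0 := by
    simp only [hh', hq1, hα]
    push_cast
    field_simp
    simp
  -- The factor $2^{-(2n-1)}$ is the loss in `half_pow_mul_abs_sub_le`; this is why $l\ge1/2$.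
  have hη' : 0 < η * (1 / 2) ^ (2 * n - 1) := by positivity
  have hev : ∀ᶠ x in 𝓝[Icc l 1] (1 : ℝ), ‖h' x‖ < η * (1 / 2) ^ (2 * n - 1) := by
    have := (hc 1 h1).norm
    rw [ContinuousWithinAt, h0, norm_zero] at this
    exact this.eventually (gt_mem_nhds hη')
  obtain ⟨δ, hδ, hball⟩ := Metric.mem_nhdsWithin_iff.1 hev
  set r := max l (1 - δ / 2) with hr
  have hrl : l ≤ r := le_max_left _ _
  have hrδ : 1 - δ / 2 ≤ r := le_max_right _ _
  refine ⟨r, by linarith, max_lt hl1 (by linarith), fun x hx y hy => ?_⟩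
  have hsub : Icc r 1 ⊆ Icc l 1 := Icc_subset_Icc_left hrl
  have hmv := (convex_Icc r 1).norm_image_sub_le_of_norm_hasDerivWithin_le
    (f := h) (f' := h') (C := η * (1 / 2) ^ (2 * n - 1))
    (fun z hz => (hd z (hsub hz)).mono hsub) (fun z hz => by
      refine le_of_lt (hball ⟨?_, hsub hz⟩)
      rw [Metric.mem_ball, Real.dist_eq, abs_lt]
      constructor <;> linarith [hz.1, hz.2]) hy hx
  have e : q x - q y - α * ((x ^ (2 * n) - y ^ (2 * n) : ℝ) : ℂ) = h x - h y := by
    simp only [hh]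
    push_cast
    ring
  rw [e]
  refine hmv.trans ?_
  rw [mul_assoc, Real.norm_eq_abs]
  refine mul_le_mul_of_nonneg_left ?_ hη.le
  have := half_pow_mul_abs_sub_le (x := x) (y := y) (by linarith [hx.1]) (by linarith [hy.1])
    (2 * n - 1)
  rwa [Nat.sub_add_cancel (by omega)] at this

/-! ### The limit of the quotients of symmetrized moments -/

namespace RadialWeight

variable (w : RadialWeight)

theorem ae_norm_le_of_memLp_top {q : ℝ → ℂ} (hq : MemLp q ∞ w.μ) :
    ∃ C : ℝ, 0 ≤ C ∧ ∀ᵐ x ∂w.μ, ‖q x‖ ≤ C := by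
  refine ⟨(eLpNorm q ∞ w.μ).toReal, ENNReal.toReal_nonneg, ?_⟩
  have h := ae_le_eLpNormEssSup (f := q) (μ := w.μ)
  have hfin : eLpNormEssSup q w.μ ≠ ∞ := by
    have := hq.2
    rw [eLpNorm_exponent_top] at this
    exact this.ne
  filter_upwards [h] with x hx
  rw [eLpNorm_exponent_top, ← toReal_enorm]
  exact (ENNReal.toReal_le_toReal (by simp) hfin).2 hx

/-- The integrand of the difference to $\alpha$ times the denominator is split at $r$. If both
variables are at least $r$, the first-order estimate gives $\eta/2$ times the integrand of
`varMoment`; otherwise $xy\le r$ and the integrand is at most $Mr^j$, negligible against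
`varMoment`. -/
theorem tendsto_covMoment_div_varMoment {q : ℝ → ℂ} (hq : MemLp q ∞ w.μ)
    (hqd : ∃ ε > 0, ContDiffOn ℝ 1 q (Icc (1 - ε) 1)) {n : ℕ} (hn : 1 ≤ n) :
    Tendsto (fun j => w.covMoment q n j / w.varMoment n j) atTop
      (𝓝 (derivWithin q (Icc 0 1) 1 / (2 * n))) := by
  obtain ⟨ε, hε, hqd⟩ := hqd
  obtain ⟨C, hC0, hC⟩ := w.ae_norm_le_of_memLp_top hq
  set α : ℂ := derivWithin q (Icc 0 1) 1 / (2 * n) with hα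
  rw [Metric.tendsto_atTop]
  intro η hη
  obtain ⟨r, hr0, hr1, hr⟩ := exists_norm_sub_sub_le_near_one hε hqd hn (half_pos hη)
  set M := 2 * C + ‖α‖ with hM
  have hM0 : 0 ≤ M := by positivity
  have hlim : Tendsto (fun j => η / 2 + M * (r ^ j / w.varMoment n j)) atTop (𝓝 (η / 2)) := by
    simpa using ((w.tendsto_pow_div_varMoment hn hr0 hr1).const_mul M).const_add (η / 2)
  obtain ⟨N, hN⟩ := eventually_atTop.1 (hlim.eventually (gt_mem_nhds (half_lt_self hη)))
  refine ⟨N, fun j hj => lt_of_le_of_lt ?_ (hN j hj)⟩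
  have hS := w.varMoment_pos hn j
  have hvi : Integrable (fun p : ℝ × ℝ => (p.1 ^ (2 * n) - p.2 ^ (2 * n)) ^ 2 * (p.1 * p.2) ^ j)
      (w.μ.prod w.μ) := integrable_mul_pow_of_mem_Icc (measurable_fst.mul measurable_snd)
    w.ae_mul_mem_Icc (w.integrable_sq_pow_sub_pow (2 * n)) j
  have hS' : (w.varMoment n j : ℂ) = ∫ p : ℝ × ℝ, (((p.1 ^ (2 * n) - p.2 ^ (2 * n)) ^ 2 *
      (p.1 * p.2) ^ j : ℝ) : ℂ) ∂(w.μ.prod w.μ) := integral_complex_ofReal.symm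
  have hvc : Integrable (fun p : ℝ × ℝ => α * (((p.1 ^ (2 * n) - p.2 ^ (2 * n)) ^ 2 *
      (p.1 * p.2) ^ j : ℝ) : ℂ)) (w.μ.prod w.μ) := hvi.ofReal.const_mul α
  have hbound : ‖w.covMoment q n j - α * w.varMoment n j‖ ≤
      η / 2 * w.varMoment n j + M * r ^ j := by
    rw [hS', ← integral_const_mul, covMoment,
      ← integral_sub (w.integrable_covMoment hq n j).1 hvc]
    have hconst : M * r ^ j = ∫ _ : ℝ × ℝ, M * r ^ j ∂(w.μ.prod w.μ) := by simp
    rw [hconst, varMoment, ← integral_const_mul,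
      ← integral_add (hvi.const_mul _) (integrable_const _)]
    refine norm_integral_le_of_norm_le ((hvi.const_mul _).add (integrable_const _)) ?_
    filter_upwards [w.ae_prod_mem_Ico, w.ae_abs_pow_sub_pow_le (2 * n),
      Measure.quasiMeasurePreserving_fst.ae hC, Measure.quasiMeasurePreserving_snd.ae hC]
      with p hp hp1 hq1 hq2
    have hpp : 0 ≤ p.1 * p.2 := mul_nonneg hp.1.1 hp.2.1
    set u := p.1 ^ (2 * n) - p.2 ^ (2 * n) with hu
    have e : (q p.1 - q p.2) * (u : ℂ) * (((p.1 * p.2) ^ j : ℝ) : ℂ) -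
        α * ((u ^ 2 * (p.1 * p.2) ^ j : ℝ) : ℂ) =
        (q p.1 - q p.2 - α * (u : ℂ)) * (u : ℂ) * (((p.1 * p.2) ^ j : ℝ) : ℂ) := by
      push_cast
      ring
    rw [e, norm_mul, norm_mul, Complex.norm_real, Complex.norm_real, Real.norm_eq_abs,
      Real.norm_of_nonneg (pow_nonneg hpp j)]
    by_cases hnear : r ≤ p.1 ∧ r ≤ p.2
    · have h1 := hr p.1 ⟨hnear.1, hp.1.2.le⟩ p.2 ⟨hnear.2, hp.2.2.le⟩
      have h2 : ‖q p.1 - q p.2 - α * (u : ℂ)‖ * |u| * (p.1 * p.2) ^ j ≤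
          η / 2 * |u| * |u| * (p.1 * p.2) ^ j := by gcongr
      have h3 : 0 ≤ M * r ^ j := by positivity
      have h4 : η / 2 * |u| * |u| * (p.1 * p.2) ^ j = η / 2 * (u ^ 2 * (p.1 * p.2) ^ j) := by
        rw [mul_assoc (η / 2), abs_mul_abs_self]
        ring
      linarith
    · have h1 : p.1 * p.2 ≤ r := by
        rcases not_and_or.1 hnear with h | h
        · exact (mul_le_of_le_one_right hp.1.1 hp.2.2.le).trans (not_le.1 h).le
        · exact (mul_le_of_le_one_left hp.2.1 hp.1.2.le).trans (not_le.1 h).le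
      have h2 : ‖q p.1 - q p.2 - α * (u : ℂ)‖ ≤ M := by
        calc ‖q p.1 - q p.2 - α * (u : ℂ)‖ ≤ ‖q p.1 - q p.2‖ + ‖α * (u : ℂ)‖ := norm_sub_le _ _
          _ ≤ (‖q p.1‖ + ‖q p.2‖) + ‖α‖ * |u| := by
            rw [norm_mul, Complex.norm_real, Real.norm_eq_abs]
            gcongr
            exact norm_sub_le _ _
          _ ≤ (C + C) + ‖α‖ * 1 := by gcongr
          _ = M := by rw [hM]; ring
      have h3 : ‖q p.1 - q p.2 - α * (u : ℂ)‖ * |u| * (p.1 * p.2) ^ j ≤ M * 1 * r ^ j := by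
        gcongr
      have h4 : 0 ≤ η / 2 * (u ^ 2 * (p.1 * p.2) ^ j) := by positivity
      linarith
  have hne : (w.varMoment n j : ℂ) ≠ 0 := by exact_mod_cast hS.ne'
  rw [dist_eq_norm, div_sub' hne, norm_div, Complex.norm_real, Real.norm_of_nonneg hS.le,
    div_le_iff₀ hS, mul_comm _ α]
  refine hbound.trans (le_of_eq ?_)
  field_simp

/-! ### The matrix coefficients of `T` and `D` -/

/-- The weights of the shift `T_{z^n}`. -/
def shiftWeight (n k : ℕ) : ℝ := √(w.natMoment (2 * (k + n)) / w.natMoment (2 * k))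

/-- The diagonal of `T_{q(|z|)}`. -/
def radialEigenvalue (q : ℝ → ℂ) (k : ℕ) : ℂ := w.symbolMoment q (2 * k) / w.natMoment (2 * k)

theorem shiftWeight_sq (n k : ℕ) :
    w.shiftWeight n k ^ 2 = w.natMoment (2 * (k + n)) / w.natMoment (2 * k) :=
  Real.sq_sqrt (div_pos (w.natMoment_pos _) (w.natMoment_pos _)).le

theorem shiftGap_add (n k : ℕ) : shiftGap (w.shiftWeight n) n (k + n) =
    w.varMoment n (2 * k) / (2 * w.natMoment (2 * k) * w.natMoment (2 * (k + n))) := by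
  have h1 := (w.natMoment_pos (2 * k)).ne'
  have h2 := (w.natMoment_pos (2 * (k + n))).ne'
  have e1 : 2 * (k + n + n) = 2 * k + 4 * n := by ring
  have e2 : 2 * k + 2 * n = 2 * (k + n) := by ring
  rw [shiftGap, if_pos (by omega), Nat.add_sub_cancel, shiftWeight_sq, shiftWeight_sq,
    varMoment_eq, e1, e2]
  field_simp

/-- For $k\ge n$ this is strict log-convexity of the moments; for $k<n$ the entry is just $a_k^2$.
-/
theorem shiftGap_pos {n : ℕ} (hn : 1 ≤ n) (k : ℕ) : 0 < shiftGap (w.shiftWeight n) n k := by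
  rcases le_or_gt n k with h | h
  · obtain ⟨i, rfl⟩ := Nat.exists_eq_add_of_le' h
    rw [shiftGap_add]
    exact div_pos (w.varMoment_pos hn _)
      (mul_pos (mul_pos two_pos (w.natMoment_pos _)) (w.natMoment_pos _))
  · rw [shiftGap, if_neg (by omega), sub_zero, shiftWeight_sq]
    exact div_pos (w.natMoment_pos _) (w.natMoment_pos _)

theorem radialEigenvalue_sub {q : ℝ → ℂ} (hq : MemLp q ∞ w.μ) {n : ℕ} (hn : 1 ≤ n) (k : ℕ) :
    w.radialEigenvalue q (k + n) - w.radialEigenvalue q k =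
      w.covMoment q n (2 * k) / w.varMoment n (2 * k) *
        (shiftGap (w.shiftWeight n) n (k + n) : ℂ) := by
  have h1 : (w.natMoment (2 * k) : ℂ) ≠ 0 := by exact_mod_cast (w.natMoment_pos _).ne'
  have h2 : (w.natMoment (2 * (k + n)) : ℂ) ≠ 0 := by exact_mod_cast (w.natMoment_pos _).ne'
  have h3 : (w.varMoment n (2 * k) : ℂ) ≠ 0 := by exact_mod_cast (w.varMoment_pos hn _).ne'
  have e2 : 2 * k + 2 * n = 2 * (k + n) := by ring
  rw [shiftGap_add, (w.integrable_covMoment hq n _).2, radialEigenvalue, radialEigenvalue, e2]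
  push_cast
  field_simp

theorem tendsto_shiftWeight (n : ℕ) : Tendsto (w.shiftWeight n) atTop (𝓝 1) := by
  have h := (w.tendsto_natMoment_add_div (2 * n)).comp
    (tendsto_id.const_mul_atTop' (two_pos : 0 < 2))
  have h2 := (Real.continuous_sqrt.tendsto 1).comp h
  rw [Real.sqrt_one] at h2
  refine h2.congr fun k => ?_
  simp only [Function.comp, shiftWeight, id, mul_add]

theorem tendsto_shiftGap_ratio {n : ℕ} (hn : 1 ≤ n) : Tendsto (fun k =>
    √(shiftGap (w.shiftWeight n) n (k + n)) / √(shiftGap (w.shiftWeight n) n k))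
    atTop (𝓝 1) := by
  have ht : Tendsto (fun k : ℕ => 2 * k) atTop atTop :=
    tendsto_id.const_mul_atTop' (two_pos : 0 < 2)
  have h1 := (w.tendsto_varMoment_add_div hn (2 * n)).comp ht
  have h2 := ((w.tendsto_natMoment_add_div (4 * n)).comp ht).inv₀ one_ne_zero
  have h := (Real.continuous_sqrt.tendsto (1 * 1⁻¹)).comp (h1.mul h2)
  rw [inv_one, mul_one, Real.sqrt_one] at h
  -- Passing to index $k+n$ makes `shiftGap_add` available for both entries; the quotient becomes
  -- one of shifted `varMoment`s times one of shifted moments.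
  refine (tendsto_add_atTop_iff_nat n).1 (h.congr fun k => ?_)
  rw [← Real.sqrt_div (w.shiftGap_pos hn _).le, shiftGap_add, shiftGap_add]
  have e1 : 2 * (k + n + n) = 2 * k + 4 * n := by ring
  have e2 : 2 * (k + n) = 2 * k + 2 * n := by ring
  simp only [Function.comp]
  rw [e1, e2]
  have p1 := (w.natMoment_pos (2 * k)).ne'
  have p2 := (w.natMoment_pos (2 * k + 2 * n)).ne'
  have p3 := (w.natMoment_pos (2 * k + 4 * n)).ne'
  have p4 := (w.varMoment_pos hn (2 * k)).ne'
  congr 1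
  field_simp

/-- The nonzero matrix coefficients of `J`. -/
def modelWeight (q : ℝ → ℂ) (n k : ℕ) : ℂ :=
  w.shiftWeight n k * (w.radialEigenvalue q (k + n) - w.radialEigenvalue q k) /
    (√(shiftGap (w.shiftWeight n) n k) * √(shiftGap (w.shiftWeight n) n (k + n)))

/-- Factor $\tau_k=a_k\cdot\frac{d_{k+n}-d_k}{c_{k+n}}\cdot\sqrt{c_{k+n}/c_k}$; the limits are $1$,
$\alpha$ and $1$. -/
theorem tendsto_modelWeight {q : ℝ → ℂ} (hq : MemLp q ∞ w.μ)
    (hqd : ∃ ε > 0, ContDiffOn ℝ 1 q (Icc (1 - ε) 1)) {n : ℕ} (hn : 1 ≤ n) :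
    Tendsto (w.modelWeight q n) atTop (𝓝 (derivWithin q (Icc 0 1) 1 / (2 * n))) := by
  have ht : Tendsto (fun k : ℕ => 2 * k) atTop atTop :=
    tendsto_id.const_mul_atTop' (two_pos : 0 < 2)
  have h1 := (Complex.continuous_ofReal.tendsto 1).comp (w.tendsto_shiftWeight n)
  have h2 := (w.tendsto_covMoment_div_varMoment hq hqd hn).comp ht
  have h3 := (Complex.continuous_ofReal.tendsto 1).comp (w.tendsto_shiftGap_ratio hn)
  have h := (h1.mul h2).mul h3
  rw [Complex.ofReal_one, one_mul, mul_one] at h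
  refine h.congr fun k => ?_
  rw [modelWeight, w.radialEigenvalue_sub hq hn]
  have p1 : (√(shiftGap (w.shiftWeight n) n k) : ℂ) ≠ 0 := by
    exact_mod_cast (Real.sqrt_pos.2 (w.shiftGap_pos hn k)).ne'
  have p2 : (√(shiftGap (w.shiftWeight n) n (k + n)) : ℂ) ≠ 0 := by
    exact_mod_cast (Real.sqrt_pos.2 (w.shiftGap_pos hn (k + n))).ne'
  have e : (shiftGap (w.shiftWeight n) n (k + n) : ℂ) =
      (√(shiftGap (w.shiftWeight n) n (k + n)) : ℂ) * √(shiftGap (w.shiftWeight n) n (k + n)) := by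
    rw [← Complex.ofReal_mul, Real.mul_self_sqrt (w.shiftGap_pos hn _).le]
  simp only [Function.comp, Complex.ofReal_div]
  rw [e]
  field_simp

end RadialWeight

/-! ### Inner products of monomials and Toeplitz matrix coefficients -/

namespace RadialWeight

theorem integral_angleMeasure (F : ℝ → ℂ) : ∫ θ, F θ ∂angleMeasure =
    (2 * Real.pi : ℂ)⁻¹ * ∫ θ in (0 : ℝ)..(2 * Real.pi), F θ := by
  have hpi : (0 : ℝ) < 2 * Real.pi := by positivity
  rw [angleMeasure, integral_smul_measure, intervalIntegral.integral_of_le hpi.le,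
    ENNReal.toReal_ofReal (by positivity), Complex.real_smul]
  simp

theorem integral_exp_angleMeasure (j k : ℕ) :
    ∫ θ : ℝ, starRingEnd ℂ (Complex.exp (θ * Complex.I) ^ j) * Complex.exp (θ * Complex.I) ^ k
      ∂angleMeasure = if j = k then 1 else 0 := by
  have e : ∀ θ : ℝ, starRingEnd ℂ (Complex.exp (θ * Complex.I) ^ j) *
      Complex.exp (θ * Complex.I) ^ k = Complex.exp ((((k : ℤ) - (j : ℤ) : ℤ) * Complex.I) * θ) := by
    intro θ
    rw [← Complex.exp_nat_mul, ← Complex.exp_nat_mul, ← Complex.exp_conj, ← Complex.exp_add]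
    congr 1
    simp only [map_mul, Complex.conj_natCast, Complex.conj_ofReal, Complex.conj_I]
    push_cast
    ring
  simp only [e]
  split_ifs with h
  · simp [h]
  · rw [integral_angleMeasure, integral_exp_mul_complex]
    · have h1 : Complex.exp ((((k : ℤ) - (j : ℤ) : ℤ) * Complex.I) * ((2 * Real.pi : ℝ) : ℂ)) = 1 := by
        rw [← Complex.exp_int_mul_two_pi_mul_I ((k : ℤ) - (j : ℤ))]
        congr 1
        push_cast
        ring
      rw [h1]
      simp
    · refine mul_ne_zero ?_ Complex.I_ne_zero
      exact_mod_cast (by omega : (k : ℤ) - (j : ℤ) ≠ 0)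

variable (w : RadialWeight)

theorem bergman_inner_smul_left (c : ℂ) (f g : w.bergman) :
    ⟪c • f, g⟫_ℂ = starRingEnd ℂ c * ⟪f, g⟫_ℂ := inner_smul_left f g c

theorem bergman_inner_smul_right (c : ℂ) (f g : w.bergman) :
    ⟪f, c • g⟫_ℂ = c * ⟪f, g⟫_ℂ := inner_smul_right f g c

theorem integral_radial_mul_monomials {q : ℝ → ℂ} (hq : MemLp q ∞ w.μ) (j k : ℕ) :
    ∫ z, q ‖z‖ * (starRingEnd ℂ (z ^ j) * z ^ k) ∂w.diskMeasure =
      if j = k then w.symbolMoment q (2 * k) else 0 := by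
  have hm : AEStronglyMeasurable (fun z : ℂ => q ‖z‖ * (starRingEnd ℂ (z ^ j) * z ^ k))
      w.diskMeasure :=
    (w.memLp_radial hq).1.mul (by fun_prop)
  rw [diskMeasure, integral_map measurable_polar.aemeasurable hm]
  have e : (fun p : ℝ × ℝ => q ‖polar p‖ * (starRingEnd ℂ (polar p ^ j) * polar p ^ k))
      =ᵐ[w.μ.prod angleMeasure] fun p => (q p.1 * (p.1 : ℂ) ^ (j + k)) *
        (starRingEnd ℂ (Complex.exp (p.2 * Complex.I) ^ j) * Complex.exp (p.2 * Complex.I) ^ k) := by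
    have h1 : ∀ᵐ p ∂(w.μ.prod angleMeasure), p.1 ∈ Ico (0 : ℝ) 1 :=
      Measure.quasiMeasurePreserving_fst.ae w.ae_mem_Ico
    filter_upwards [h1] with p hp
    rw [norm_polar, abs_of_nonneg hp.1, polar]
    simp only [mul_pow, map_mul, map_pow, Complex.conj_ofReal]
    ring
  rw [integral_congr_ae e, integral_prod_mul (fun x : ℝ => q x * (x : ℂ) ^ (j + k))
    (fun θ : ℝ => starRingEnd ℂ (Complex.exp (θ * Complex.I) ^ j) *
      Complex.exp (θ * Complex.I) ^ k), integral_exp_angleMeasure]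
  split_ifs with h
  · rw [mul_one, symbolMoment, h, two_mul]
  · rw [mul_zero]

theorem symbolMoment_one (j : ℕ) : w.symbolMoment (fun _ => 1) j = w.natMoment j := by
  rw [natMoment, ← integral_complex_ofReal, symbolMoment]
  simp

theorem monomial_ae (k : ℕ) : ((w.monomial k : w.bergman) : Lp ℂ 2 w.diskMeasure)
    =ᵐ[w.diskMeasure] fun z => z ^ k := (w.memLp_pow k 2).coeFn_toLp

theorem inner_monomial_left (k : ℕ) (f : Lp ℂ 2 w.diskMeasure) :
    ⟪((w.monomial k : w.bergman) : Lp ℂ 2 w.diskMeasure), f⟫_ℂ =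
      ∫ z, starRingEnd ℂ (z ^ k) * f z ∂w.diskMeasure := by
  rw [L2.inner_def]
  refine integral_congr_ae ?_
  filter_upwards [w.monomial_ae k] with z hz
  rw [hz, RCLike.inner_apply, mul_comm]

theorem inner_monomial (j k : ℕ) : ⟪w.monomial j, w.monomial k⟫_ℂ =
    if j = k then (w.natMoment (2 * k) : ℂ) else 0 := by
  rw [Submodule.coe_inner, inner_monomial_left, ← symbolMoment_one,
    ← w.integral_radial_mul_monomials (memLp_const 1)]
  refine integral_congr_ae ?_
  filter_upwards [w.monomial_ae k] with z hz
  rw [hz, one_mul]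

theorem inner_toeplitz (φ : ℂ → ℂ) (hφ : MemLp φ ∞ w.diskMeasure) (j k : ℕ) :
    ⟪w.monomial j, w.toeplitz φ hφ (w.monomial k)⟫_ℂ =
      ∫ z, φ z * (starRingEnd ℂ (z ^ j) * z ^ k) ∂w.diskMeasure := by
  have h : w.toeplitz φ hφ (w.monomial k) = w.bergman.orthogonalProjectionOnto
      ((ContinuousLinearMap.mul ℂ ℂ).holder 2 hφ.toLp
        (w.monomial k : Lp ℂ 2 w.diskMeasure)) := rfl
  rw [h, Submodule.inner_orthogonalProjectionOnto_eq_of_mem_left, inner_monomial_left]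
  refine integral_congr_ae ?_
  filter_upwards [w.monomial_ae k, hφ.coeFn_toLp, (ContinuousLinearMap.mul ℂ ℂ).coeFn_holder
    (r := 2) hφ.toLp (w.monomial k : Lp ℂ 2 w.diskMeasure)] with z h1 h2 h3
  rw [h3, h1, h2, ContinuousLinearMap.mul_apply']
  ring

/-! ### Completeness of the monomials -/

/-- On $|z|=r$ one has $\bar z=r^2/z$, so the left side is $r^{2k}$ times Cauchy's integral for the
$k$-th Taylor coefficient. Uniqueness of power series makes that coefficient independent of the
radius; $1/2$ is an arbitrary reference. -/
theorem integral_angleMeasure_conj_pow_mul {g : ℂ → ℂ}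
    (hg : AnalyticOnNhd ℂ g (Metric.ball 0 1)) (k : ℕ) {r : ℝ} (hr : r ∈ Ico (0 : ℝ) 1) :
    ∫ θ, starRingEnd ℂ (polar (r, θ) ^ k) * g (polar (r, θ)) ∂angleMeasure =
      (cauchyPowerSeries g 0 (1 / 2)).coeff k * (r : ℂ) ^ (2 * k) := by
  have hps : ∀ R : ℝ, 0 < R → R < 1 →
      HasFPowerSeriesAt g (cauchyPowerSeries g 0 R) 0 := by
    intro R h0 h1
    have hd : DifferentiableOn ℂ g (Metric.closedBall 0 (⟨R, h0.le⟩ : NNReal)) :=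
      hg.differentiableOn.mono (Metric.closedBall_subset_ball h1)
    exact (hd.hasFPowerSeriesOnBall (R := ⟨R, h0.le⟩) h0).hasFPowerSeriesAt
  have hhalf := hps (1 / 2) (by norm_num) (by norm_num)
  -- The circle degenerates at $r=0$, where only $k=0$ contributes.
  rcases hr.1.eq_or_lt with h0 | h0
  · rw [← h0]
    have hp : ∀ θ : ℝ, polar (0, θ) = 0 := fun θ => by simp [polar]
    simp only [hp]
    rcases Nat.eq_zero_or_pos k with rfl | hk
    · have := hhalf.coeff_zero (fun _ => 1)
      have e : (cauchyPowerSeries g 0 (1 / 2)).coeff 0 = g 0 := by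
        rw [← this]
        rfl
      rw [e]
      simp
    · simp [hk.ne']
  · have e1 : (cauchyPowerSeries g 0 (1 / 2)).coeff k = (cauchyPowerSeries g 0 r).coeff k := by
      rw [hhalf.eq_formalMultilinearSeries (hps r h0 hr.2)]
    have hr0 : (r : ℂ) ≠ 0 := by exact_mod_cast h0.ne'
    have e2 : (cauchyPowerSeries g 0 r).coeff k = (2 * Real.pi * Complex.I : ℂ)⁻¹ •
        ∮ z in C(0, r), (1 / (z - 0)) ^ k • (z - 0)⁻¹ • g z := by
      rw [← cauchyPowerSeries_apply]
      rfl
    rw [e1, e2, integral_angleMeasure, circleIntegral, smul_eq_mul,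
      mul_inv (2 * Real.pi : ℂ) Complex.I, mul_assoc (2 * Real.pi : ℂ)⁻¹,
      mul_assoc (2 * Real.pi : ℂ)⁻¹]
    congr 1
    rw [← intervalIntegral.integral_const_mul, ← intervalIntegral.integral_mul_const]
    refine intervalIntegral.integral_congr fun θ _ => ?_
    have hz : circleMap 0 r θ = polar (r, θ) := by simp [circleMap, polar]
    have hz0 : polar (r, θ) ≠ 0 := by
      rw [← norm_ne_zero_iff, norm_polar]
      exact (abs_pos.2 h0.ne').ne'
    have hc : starRingEnd ℂ (polar (r, θ)) = (r : ℂ) ^ 2 * (polar (r, θ))⁻¹ := by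
      rw [eq_mul_inv_iff_mul_eq₀ hz0, mul_comm, Complex.mul_conj, Complex.normSq_eq_norm_sq,
        norm_polar, sq_abs]
      push_cast
      rfl
    simp only [deriv_circleMap, hz, sub_zero, smul_eq_mul, map_pow, hc, mul_pow, one_div, inv_pow,
      ← pow_mul]
    field_simp

theorem eq_zero_of_forall_coeff_eq_zero {g : ℂ → ℂ} (hg : AnalyticOnNhd ℂ g (Metric.ball 0 1))
    (h : ∀ k, (cauchyPowerSeries g 0 (1 / 2)).coeff k = 0) {z : ℂ} (hz : z ∈ Metric.ball (0 : ℂ) 1) :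
    g z = 0 := by
  have hd : DifferentiableOn ℂ g (Metric.closedBall 0 ((1 / 2 : NNReal) : ℝ)) :=
    hg.differentiableOn.mono (Metric.closedBall_subset_ball (by norm_num))
  have hps := (hd.hasFPowerSeriesOnBall (by norm_num)).hasFPowerSeriesAt
  have hev : g =ᶠ[𝓝 0] 0 := by
    filter_upwards [hasFPowerSeriesAt_iff.1 hps] with y hy
    have hc : ∀ k, (cauchyPowerSeries g 0 ((1 / 2 : NNReal) : ℝ)).coeff k = 0 := by
      intro k
      simpa using h k
    simp only [hc, smul_zero, zero_add] at hy
    exact hy.unique hasSum_zero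
  exact hg.eqOn_zero_of_preconnected_of_eventuallyEq_zero
    (convex_ball 0 1).isPreconnected (Metric.mem_ball_self one_pos) hev hz

/-- In polar coordinates the inner product with $z^k$ is the $k$-th Taylor coefficient times
$\gamma_{2k}>0$. So all coefficients vanish, and the identity theorem kills the analytic
representative on the whole disk. -/
theorem eq_zero_of_inner_monomial (f : w.bergman) (h : ∀ k, ⟪w.monomial k, f⟫_ℂ = 0) : f = 0 := by
  obtain ⟨f, g, hg, hfg⟩ := f
  have hcoeff : ∀ k, (cauchyPowerSeries g 0 (1 / 2)).coeff k = 0 := by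
    intro k
    have h1 : ∫ z, starRingEnd ℂ (z ^ k) * g z ∂w.diskMeasure = 0 := by
      refine Eq.trans ?_ ((w.inner_monomial_left k f).symm.trans (h k))
      refine integral_congr_ae ?_
      filter_upwards [hfg] with z hz
      rw [hz]
    have hint : Integrable (fun z => starRingEnd ℂ (z ^ k) * g z) w.diskMeasure := by
      refine (L2.integrable_inner (𝕜 := ℂ) ((w.monomial k : w.bergman) :
        Lp ℂ 2 w.diskMeasure) f).congr ?_
      filter_upwards [hfg, w.monomial_ae k] with z hz hk
      rw [hz, hk, RCLike.inner_apply, mul_comm]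
    have hint' : Integrable (fun p : ℝ × ℝ => starRingEnd ℂ (polar p ^ k) * g (polar p))
        (w.μ.prod angleMeasure) := hint.comp_measurable measurable_polar
    rw [diskMeasure, integral_map measurable_polar.aemeasurable hint.1,
      integral_prod _ hint'] at h1
    have h2 : ∫ r, (cauchyPowerSeries g 0 (1 / 2)).coeff k * (r : ℂ) ^ (2 * k) ∂w.μ = 0 := by
      refine Eq.trans (integral_congr_ae ?_) h1
      filter_upwards [w.ae_mem_Ico] with r hr
      exact (integral_angleMeasure_conj_pow_mul hg k hr).symm
    have h3 : ∫ r : ℝ, (r : ℂ) ^ (2 * k) ∂w.μ = w.natMoment (2 * k) := by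
      simpa [symbolMoment] using w.symbolMoment_one (2 * k)
    rw [integral_const_mul, h3] at h2
    refine (mul_eq_zero.1 h2).resolve_right ?_
    exact_mod_cast (w.natMoment_pos _).ne'
  refine Subtype.ext (Lp.ext ?_)
  filter_upwards [hfg, w.ae_mem_ball, Lp.coeFn_zero ℂ 2 w.diskMeasure] with z hz hb h0
  change f z = (0 : Lp ℂ 2 w.diskMeasure) z
  rw [hz, h0, eq_zero_of_forall_coeff_eq_zero hg hcoeff hb]
  rfl

theorem ext_inner_monomial {f g : w.bergman}
    (h : ∀ k, ⟪w.monomial k, f⟫_ℂ = ⟪w.monomial k, g⟫_ℂ) : f = g :=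
  sub_eq_zero.1 (w.eq_zero_of_inner_monomial _ fun k => by rw [inner_sub_right, h, sub_self])

theorem shiftT_monomial (n k : ℕ) : w.shiftT n (w.monomial k) = w.monomial (k + n) := by
  refine w.ext_inner_monomial fun j => ?_
  rw [shiftT, inner_toeplitz, inner_monomial, ← symbolMoment_one,
    ← w.integral_radial_mul_monomials (memLp_const 1)]
  refine integral_congr_ae (Eventually.of_forall fun z => ?_)
  ring

theorem radialD_monomial {q : ℝ → ℂ} (hq : MemLp q ∞ w.μ) (k : ℕ) :
    w.radialD q hq (w.monomial k) = w.radialEigenvalue q k • w.monomial k := by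
  refine w.ext_inner_monomial fun j => ?_
  rw [radialD, inner_toeplitz, w.integral_radial_mul_monomials hq, bergman_inner_smul_right,
    inner_monomial, mul_ite, mul_zero, radialEigenvalue, div_mul_cancel₀]
  exact_mod_cast (w.natMoment_pos _).ne'

theorem moment_two_mul (k : ℕ) : w.moment (2 * k) = w.natMoment (2 * k) := by
  refine integral_congr_ae (Eventually.of_forall fun x => ?_)
  change x ^ (2 * (k : ℝ)) = x ^ (2 * k)
  exact_mod_cast Real.rpow_natCast x (2 * k)

theorem normalizedMonomial_eq (k : ℕ) :
    w.normalizedMonomial k = ((√(w.natMoment (2 * k)))⁻¹ : ℂ) • w.monomial k := by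
  rw [normalizedMonomial, moment_two_mul, Real.rpow_neg (w.natMoment_pos _).le,
    ← Real.sqrt_eq_rpow, Complex.ofReal_inv]

theorem sqrt_natMoment_ne_zero (k : ℕ) : (√(w.natMoment k) : ℂ) ≠ 0 := by
  exact_mod_cast (Real.sqrt_pos.2 (w.natMoment_pos k)).ne'

theorem orthonormal_normalizedMonomial : Orthonormal ℂ w.normalizedMonomial := by
  rw [orthonormal_iff_ite]
  intro j k
  rw [normalizedMonomial_eq, normalizedMonomial_eq, bergman_inner_smul_left, bergman_inner_smul_right,
    inner_monomial]
  split_ifs with h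
  · subst h
    rw [map_inv₀, Complex.conj_ofReal, ← mul_assoc, ← mul_inv, ← Complex.ofReal_mul,
      Real.mul_self_sqrt (w.natMoment_pos _).le, inv_mul_cancel₀]
    exact_mod_cast (w.natMoment_pos _).ne'
  · simp

/-- The orthonormal basis of normalized monomials. -/
def monomialBasis : HilbertBasis ℕ ℂ w.bergman :=
  HilbertBasis.mkOfOrthogonalEqBot w.orthonormal_normalizedMonomial (by
    rw [Submodule.eq_bot_iff]
    intro f hf
    refine w.eq_zero_of_inner_monomial f fun k => ?_
    have h := (Submodule.mem_orthogonal _ f).1 hf _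
      (Submodule.subset_span (mem_range_self (f := w.normalizedMonomial) k))
    rw [normalizedMonomial_eq, bergman_inner_smul_left, mul_eq_zero, map_inv₀, Complex.conj_ofReal] at h
    exact h.resolve_left (inv_ne_zero (w.sqrt_natMoment_ne_zero _)))

theorem monomialBasis_apply (k : ℕ) : w.monomialBasis k = w.normalizedMonomial k := by
  simp [monomialBasis]

theorem shiftT_basis (n k : ℕ) : w.shiftT n (w.monomialBasis k) =
    (w.shiftWeight n k : ℂ) • w.monomialBasis (k + n) := by
  rw [monomialBasis_apply, monomialBasis_apply, normalizedMonomial_eq, normalizedMonomial_eq,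
    map_smul, shiftT_monomial, smul_smul, shiftWeight, Real.sqrt_div (w.natMoment_pos _).le]
  have h1 := w.sqrt_natMoment_ne_zero (2 * k)
  have h2 := w.sqrt_natMoment_ne_zero (2 * (k + n))
  congr 1
  push_cast
  field_simp

theorem radialD_basis {q : ℝ → ℂ} (hq : MemLp q ∞ w.μ) (k : ℕ) :
    w.radialD q hq (w.monomialBasis k) = w.radialEigenvalue q k • w.monomialBasis k := by
  rw [monomialBasis_apply, normalizedMonomial_eq, map_smul, radialD_monomial, smul_comm]

/-- A convergent $\tau$ is bounded, so `weightedModel` provides one $J$ for all three claims. -/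
theorem exists_isBoundedExtension_operatorJ {q : ℝ → ℂ} (hq : MemLp q ∞ w.μ)
    (hqd : ∃ ε > 0, ContDiffOn ℝ 1 q (Icc (1 - ε) 1)) {n : ℕ} (hn : 1 ≤ n) :
    ∃ J : w.bergman →L[ℂ] w.bergman,
      IsBoundedExtension (operatorJ (w.shiftT n) (w.radialD q hq)) J ∧
      IsCompactOperator
        (J - w.shiftModel w.monomialBasis n (derivWithin q (Icc 0 1) 1 / (2 * n))) ∧
      2 * (derivWithin q (Icc 0 1) 1 / (2 * n)).re ≤ ‖J‖ := by
  have hτ := w.tendsto_modelWeight hq hqd hn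
  obtain ⟨B, hB⟩ := (Metric.isBounded_range_of_tendsto _ hτ).exists_norm_le
  have hB' : ∀ k, ‖w.modelWeight q n k‖ ≤ B := fun k => hB _ (mem_range_self k)
  have hB0 : 0 ≤ B := (norm_nonneg _).trans (hB' 0)
  refine ⟨weightedModel w.monomialBasis n (w.modelWeight q n) hB0 hB', ?_,
    isCompactOperator_weightedModel_sub _ n hB0 hB' hτ,
    two_mul_re_le_norm_weightedModel _ hn hB0 hB' hτ⟩
  refine isBoundedExtension_weightedModel w.monomialBasis (w.shiftT_basis n) (w.radialD_basis hq)
    (w.shiftGap_pos hn) (fun k => ?_) hB0 hB'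
  rw [modelWeight, mul_div_cancel₀]
  refine mul_ne_zero ?_ ?_ <;>
  exact_mod_cast (Real.sqrt_pos.2 (w.shiftGap_pos hn _)).ne'

end RadialWeight

end

/-! ### Conclusion and the symbols $t^s$ -/

theorem theorem2 (w : RadialWeight) (n : ℕ) (hn : 1 ≤ n) :
    (∀ (q : ℝ → ℂ) (hq : MemLp q ∞ w.μ),
      (∃ ε > 0, ContDiffOn ℝ 1 q (Icc (1 - ε) 1)) →
      ∃ b : HilbertBasis ℕ ℂ w.bergman,
        (∀ k, b k = w.normalizedMonomial k) ∧
        IsWeightedShift b n (w.shiftT n) ∧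
        IsHyponormal (w.shiftT n) ∧
        (∀ f, selfCommutator (w.shiftT n) f = 0 → f = 0) ∧
        IsDiagonal b (w.radialD q hq) ∧
        ∃ J : w.bergman →L[ℂ] w.bergman,
          IsBoundedExtension (operatorJ (w.shiftT n) (w.radialD q hq)) J ∧
          IsCompactOperator
            (J - w.shiftModel b n (derivWithin q (Icc 0 1) 1 / (2 * n)))) ∧
    (∀ (s : ℝ) (hs : 0 < s),
      ∃ J : w.bergman →L[ℂ] w.bergman,
        IsBoundedExtension
          (operatorJ (w.shiftT n)
            (w.radialD (fun t => ((t ^ s : ℝ) : ℂ)) (w.memLp_rpow hs.le))) J ∧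
        s / n ≤ ‖J‖) := by
  constructor
  · intro q hq hqd
    have hC := selfCommutator_shift_apply w.monomialBasis (w.shiftT_basis n)
    obtain ⟨J, h1, h2, -⟩ := w.exists_isBoundedExtension_operatorJ hq hqd hn
    exact ⟨w.monomialBasis, w.monomialBasis_apply, ⟨_, w.shiftT_basis n⟩,
      isPositive_of_diagonal _ hC fun k => (w.shiftGap_pos hn k).le,
      eq_zero_of_diagonal _ hC (w.shiftGap_pos hn), ⟨_, w.radialD_basis hq⟩, J, h1, h2⟩
  · intro s hs
    -- Any interval away from 0 would do; $t^s$ need not be differentiable at 0 when $s<1$.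
    have hcd : ContDiffOn ℝ 1 (fun t : ℝ => ((t ^ s : ℝ) : ℂ)) (Icc (1 - 1 / 2) 1) := by
      refine Complex.ofRealCLM.contDiff.comp_contDiffOn fun t ht => ?_
      exact (Real.contDiffAt_rpow_const_of_ne (by linarith [ht.1])).contDiffWithinAt
    obtain ⟨J, h1, -, h3⟩ := w.exists_isBoundedExtension_operatorJ (w.memLp_rpow hs.le)
      ⟨1 / 2, by norm_num, hcd⟩ hn
    refine ⟨J, h1, le_trans (le_of_eq ?_) h3⟩
    have hd : derivWithin (fun t : ℝ => ((t ^ s : ℝ) : ℂ)) (Icc 0 1) 1 = s := by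
      have h := (Real.hasDerivAt_rpow_const (x := 1) (p := s) (Or.inl one_ne_zero)).ofReal_comp
      rw [h.hasDerivWithinAt.derivWithin (uniqueDiffOn_Icc zero_lt_one 1 ⟨zero_le_one, le_rfl⟩)]
      simp
    have e : ((s : ℂ) / (2 * n)) = ((s / (2 * n) : ℝ) : ℂ) := by push_cast; rfl
    rw [hd, e, Complex.ofReal_re]
    have : (n : ℝ) ≠ 0 := by exact_mod_cast (by omega : n ≠ 0)
    field_simp
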